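/- Let $n\ge 1$ be an integer, let $m\in\{1,2\}$, and let $\Sigma$ be a closed (that is, nonempty, compact and without boundary, but not necessarily connected) smooth embedded $n$-dimensional submanifold of the unit sphere $\mathbb S^{n+m}\subset\mathbb R^{n+m+1}$. Suppose that $\Sigma$ is minimal, that is, its mean curvature vector with respect to $\mathbb S^{n+m}$ vanishes identically. Let $|\cdot|$ denote $n$-dimensional volume. Then $$|\mathbb S^n|\le|\Sigma| .$$ Moreover, equality holds if and only if $\Sigma$ is a totally geodesic $n$-sphere, that is, the second fundamental form of $\Sigma$ with respect to $\mathbb S^{n+m}$ vanishes identically and $\Sigma$ is homeomorphic to $\mathbb S^n$; this in turn is equivalent to $\Sigma=W\cap\mathbb S^{n+m}$ for some $(n+1)$-dimensional linear subspace $W$ of $\mathbb R^{n+m+1}$. -/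

import Mathlib

open scoped ContDiff InnerProductSpace Topology

noncomputable section

namespace MinSub

/-- Euclidean space `ℝ^N`. -/
abbrev Euc (N : ℕ) : Type := EuclideanSpace ℝ (Fin N)

/-- The unit sphere `𝕊^k` in `ℝ^{k+1}`, as a set. -/
def unitSphere (k : ℕ) : Set (Euc (k + 1)) := Metric.sphere 0 1

/-- `φ`, restricted to `V ⊆ ℝ^n`, is a smooth local parametrization of the set `S ⊆ ℝ^N`:
`V` is open, and `φ` is a smooth immersion on `V` which is a homeomorphism from `V` onto a
relatively open subset of `S`. -/
structure IsLocalParam {n N : ℕ} (S : Set (Euc N)) (V : Set (Euc n)) (φ : Euc n → Euc N) :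
    Prop where
  isOpen_source : IsOpen V
  smooth : ContDiffOn ℝ ∞ φ V
  immersion : ∀ u ∈ V, Function.Injective (fderiv ℝ φ u)
  embedding : Topology.IsEmbedding (V.domRestrict φ)
  isOpen_image : ∃ U : Set (Euc N), IsOpen U ∧ φ '' V = S ∩ U

/-- `S ⊆ ℝ^N` is a (smooth, embedded) `n`-dimensional submanifold of `ℝ^N`, without boundary:
each of its points lies in the image of a smooth local parametrization by an open subset
of `ℝ^n`. -/
def IsSubmanifold (n : ℕ) {N : ℕ} (S : Set (Euc N)) : Prop :=
  ∀ x ∈ S, ∃ (V : Set (Euc n)) (φ : Euc n → Euc N), IsLocalParam S V φ ∧ x ∈ φ '' V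

/-- `S` is a closed (i.e. compact, without boundary, and nonempty) `n`-dimensional submanifold
of the unit sphere `𝕊^k ⊆ ℝ^{k+1}`.  It is not required to be connected. -/
structure IsClosedSubmanifoldOfSphere (n k : ℕ) (S : Set (Euc (k + 1))) : Prop where
  nonempty : S.Nonempty
  isCompact : IsCompact S
  subset_sphere : S ⊆ unitSphere k
  isSubmanifold : IsSubmanifold n S

/-- The tangent space at `φ u` of the submanifold parametrized by `φ`. -/
def tangentSpaceAt {n N : ℕ} (φ : Euc n → Euc N) (u : Euc n) : Submodule ℝ (Euc N) :=
  LinearMap.range (fderiv ℝ φ u).toLinearMap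

/-- The normal space at `x = φ u`, taken in the unit sphere, of a submanifold of the sphere
parametrized by `φ`: the vectors orthogonal to its tangent space and to `x`. -/
def normalSpaceAt {n N : ℕ} (φ : Euc n → Euc N) (u : Euc n) : Submodule ℝ (Euc N) :=
  (tangentSpaceAt φ u ⊔ Submodule.span ℝ {φ u})ᗮ

/-- The second fundamental form `II(X, Y) = (∇̄_X Y)^⊥` with respect to the sphere, in the local
parametrization `φ`.  The arguments `a, b ∈ ℝ^n` stand for the tangent vectors `dφ(a), dφ(b)`.
The derivative `∇̄` of the coordinate field `dφ(b)` in the direction `dφ(a)` is the second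
derivative `D²φ(a, b)`, and `⊥` is the orthogonal projection to the normal space in the sphere. -/
def secondFundForm {n N : ℕ} (φ : Euc n → Euc N) (u a b : Euc n) : Euc N :=
  (normalSpaceAt φ u).starProjection (fderiv ℝ (fderiv ℝ φ) u a b)

/-- The matrix `g_{ij} = ⟨∂_i φ, ∂_j φ⟩` of the induced metric. -/
def metricMatrix {n N : ℕ} (φ : Euc n → Euc N) (u : Euc n) : Matrix (Fin n) (Fin n) ℝ :=
  Matrix.of fun i j =>
    ⟪fderiv ℝ φ u (EuclideanSpace.single i 1), fderiv ℝ φ u (EuclideanSpace.single j 1)⟫_ℝ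

/-- The mean curvature vector with respect to the sphere,
`H = (1/n) ∑_{i,j} g^{ij} II(∂_i, ∂_j)`. -/
def meanCurvature {n N : ℕ} (φ : Euc n → Euc N) (u : Euc n) : Euc N :=
  (n : ℝ)⁻¹ • ∑ i : Fin n, ∑ j : Fin n,
    (metricMatrix φ u)⁻¹ i j •
      secondFundForm φ u (EuclideanSpace.single i 1) (EuclideanSpace.single j 1)

/-- `S` is a minimal `n`-dimensional submanifold of the unit sphere: its mean curvature vector
vanishes identically.  (The vector `H` at a point does not depend on the parametrization.) -/
def IsMinimal (n : ℕ) {N : ℕ} (S : Set (Euc N)) : Prop :=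
  ∀ (V : Set (Euc n)) (φ : Euc n → Euc N), IsLocalParam S V φ →
    ∀ u ∈ V, meanCurvature φ u = 0

/-- `S` is a totally geodesic `n`-dimensional submanifold of the unit sphere: its second
fundamental form vanishes identically. -/
def IsTotallyGeodesic (n : ℕ) {N : ℕ} (S : Set (Euc N)) : Prop :=
  ∀ (V : Set (Euc n)) (φ : Euc n → Euc N), IsLocalParam S V φ →
    ∀ u ∈ V, ∀ a b : Euc n, secondFundForm φ u a b = 0

/-- `S` is a totally geodesic `n`-sphere: totally geodesic and homeomorphic to `𝕊^n`. -/
def IsTotallyGeodesicSphere (n : ℕ) {N : ℕ} (S : Set (Euc N)) : Prop :=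
  IsTotallyGeodesic n S ∧ Nonempty (S ≃ₜ unitSphere n)

/-- `S` is a great `n`-sphere of `𝕊^k`: the intersection of `𝕊^k` with an `(n+1)`-dimensional
linear subspace of `ℝ^{k+1}`. -/
def IsGreatSphere (n k : ℕ) (S : Set (Euc (k + 1))) : Prop :=
  ∃ W : Submodule ℝ (Euc (k + 1)), Module.finrank ℝ W = n + 1 ∧ S = (W : Set _) ∩ unitSphere k

/-- The volume `|S|` of an `n`-dimensional submanifold of `ℝ^N`: its `n`-dimensional Hausdorff
measure, normalized so that it is Lebesgue measure on `ℝ^n` (this is the Riemannian volume of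
the induced metric). -/
def vol (n : ℕ) {N : ℕ} (S : Set (Euc N)) : ENNReal :=
  MeasureTheory.Measure.euclideanHausdorffMeasure n S

end MinSub

end

open MeasureTheory Set Filter
open scoped ENNReal NNReal

namespace MinSub

/-! The argument is of Alexandrov–Bakelman–Pucci type. Each `p` in the open unit ball of `ℝ^{n+m+1}`
defines a height function `⟨p, ·⟩`, which attains its maximum over the compact set `S` at some `x`.
There `p` is normal to `S`, so in an orthonormal frame `ν` of the normal space of the cone over `S`,
with `ν 0 = x`, it reads `p = ∑ y_j ν_j` with `‖y‖ < 1`; moreover minus the Hessian, `B`, is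
positive semidefinite. The unit ball is thus covered by the normal exponential map `normalMap`
restricted to the part of the bundle where `B ≥ 0`.

The Jacobian of that map relative to the volume of `S` is `|det B| / det g`, with `B = y₀ g - ⟨q,
II⟩` and `q` the component of `p` normal to `S` in the sphere. Minimality gives `tr (g⁻¹ B) = n y₀`,
so the arithmetic-geometric mean inequality bounds the Jacobian by `y₀ⁿ`
(`det_le_of_trace_inv_mul_eq`). Integrating over the bundle yields `|ball| ≤ ballConst * |S|`
(`splitVolume_ball_le`). For a great sphere `B = y₀ g`, and the map is injective on `y₀ > 0`, so the
opposite inequality holds (`ballConst_mul_vol_greatSphere_le`). Comparing the two and cancelling the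
constant gives `|𝕊^n| ≤ |S|`.

If `II ≠ 0` somewhere, then `B ≠ y₀ g` on a nonempty open part of the bundle with `y₀ > 0`, and the
estimate is strict; so equality forces `II = 0` (`isTotallyGeodesic_of_le`). When `II = 0` the
normal spaces are locally constant, each chart with connected domain lies in a linear subspace, and
`S` contains a great sphere as a relatively open subset
(`IsTotallyGeodesic.exists_greatSphere_subset`). Equality of volumes, or connectedness of `S`,
leaves no room for anything else. -/

/-! ### Localization of measure inequalities and the area formula. -/

/-- A comparison of set functions which holds locally on a measurable set holds on the set. -/
theorem le_of_forall_exists_open_le {X : Type*} [TopologicalSpace X] [SecondCountableTopology X]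
    [MeasurableSpace X] [OpensMeasurableSpace X] (α β : Set X → ℝ≥0∞) {S : Set X}
    (hS : MeasurableSet S) (hα0 : α ∅ = 0) (hα : ∀ t : ℕ → Set X, α (⋃ i, t i) ≤ ∑' i, α (t i))
    (hβ : ∀ t : ℕ → Set X, (∀ i, MeasurableSet (t i)) → Pairwise (Function.onFun Disjoint t) →
      (∀ i, t i ⊆ S) → ∑' i, β (t i) ≤ β (⋃ i, t i))
    (hloc : ∀ x ∈ S, ∃ U : Set X, IsOpen U ∧ x ∈ U ∧
      ∀ D ⊆ S ∩ U, MeasurableSet D → α D ≤ β D) : α S ≤ β S := by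
  rcases S.eq_empty_or_nonempty with rfl | ⟨x₀, hx₀⟩
  · simp [hα0]
  choose! U hU hxU hle using hloc
  obtain ⟨t, htS, htc, hcov⟩ := TopologicalSpace.countable_cover_nhdsWithin (s := S) (f := U)
    fun x hx => mem_nhdsWithin_of_mem_nhds ((hU x hx).mem_nhds (hxU x hx))
  have htne : t.Nonempty := by
    by_contra h
    rw [not_nonempty_iff_eq_empty] at h
    subst h
    simpa using hcov hx₀
  obtain ⟨f, rfl⟩ := htc.exists_eq_range htne
  let D : ℕ → Set X := disjointed fun i => S ∩ U (f i)
  have hm : ∀ i, MeasurableSet (S ∩ U (f i)) := fun i =>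
    hS.inter (hU _ (htS ⟨i, rfl⟩)).measurableSet
  have hD : ∀ i, MeasurableSet (D i) := fun i => MeasurableSet.disjointed hm i
  have hDs : ∀ i, D i ⊆ S ∩ U (f i) := fun i => disjointed_subset _ i
  have hun : ⋃ i, D i = S := by
    rw [iUnion_disjointed]
    refine Subset.antisymm (iUnion_subset fun i => inter_subset_left) fun x hx => ?_
    obtain ⟨_, ⟨i, rfl⟩, hi⟩ := mem_iUnion₂.1 (hcov hx)
    exact mem_iUnion.2 ⟨i, hx, hi⟩
  calc α S = α (⋃ i, D i) := by rw [hun]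
    _ ≤ ∑' i, α (D i) := hα D
    _ ≤ ∑' i, β (D i) := ENNReal.tsum_le_tsum fun i => hle _ (htS ⟨i, rfl⟩) _ (hDs i) (hD i)
    _ ≤ β (⋃ i, D i) := hβ D hD (disjoint_disjointed _) fun i => (hDs i).trans inter_subset_left
    _ = β S := by rw [hun]

/-- Hausdorff measure decreases up to `K ^ d` when distances decrease up to a factor `K`. -/
theorem euclideanHausdorffMeasure_image_le_of_dist_le {X Y Z : Type*} [PseudoMetricSpace X]
    [MetricSpace Y] [MeasurableSpace Y] [BorelSpace Y] [MetricSpace Z] [MeasurableSpace Z]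
    [BorelSpace Z] {f : X → Y} {g : X → Z} {D : Set X} {K : ℝ≥0} (d : ℕ)
    (h : ∀ a ∈ D, ∀ b ∈ D, dist (f a) (f b) ≤ K * dist (g a) (g b)) :
    Measure.euclideanHausdorffMeasure d (f '' D) ≤
      (K : ℝ≥0∞) ^ d * Measure.euclideanHausdorffMeasure d (g '' D) := by
  rcases D.eq_empty_or_nonempty with rfl | ⟨x₀, hx₀⟩
  · simp
  have : Nonempty X := ⟨x₀⟩
  -- `g` need not be injective; the hypothesis makes `f` constant on the fibres of `g` in `D`, so
  -- any choice of preimages gives a map with the same image.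
  let s : Z → X := Function.invFunOn g D
  have hs : ∀ z ∈ g '' D, s z ∈ D ∧ g (s z) = z := fun z hz =>
    ⟨Function.invFunOn_mem hz, Function.invFunOn_eq hz⟩
  have himg : f '' D = (f ∘ s) '' (g '' D) := by
    ext y
    constructor
    · rintro ⟨a, ha, rfl⟩
      refine ⟨g a, ⟨a, ha, rfl⟩, ?_⟩
      obtain ⟨h1, h2⟩ := hs (g a) ⟨a, ha, rfl⟩
      have := h _ h1 _ ha
      rw [h2, dist_self, mul_zero] at this
      exact dist_le_zero.1 this
    · rintro ⟨z, hz, rfl⟩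
      exact ⟨s z, (hs z hz).1, rfl⟩
  have hlip : LipschitzOnWith K (f ∘ s) (g '' D) := by
    refine LipschitzOnWith.of_dist_le_mul fun x hx y hy => ?_
    have := h _ (hs x hx).1 _ (hs y hy).1
    rwa [(hs x hx).2, (hs y hy).2] at this
  rw [himg, Measure.euclideanHausdorffMeasure_def, Measure.euclideanHausdorffMeasure_def,
    Measure.smul_apply, Measure.smul_apply, mul_smul_comm]
  have := hlip.hausdorffMeasure_image_le (d := d) (by positivity)
  rw [ENNReal.rpow_natCast] at this
  gcongr

theorem normDet_fderiv_sq {n N : ℕ} (φ : Euc n → Euc N) (u : Euc n) :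
    (fderiv ℝ φ u).toLinearMap.normDet ^ 2 = (metricMatrix φ u).det := by
  have := (fderiv ℝ φ u).toLinearMap.normDet_sq_eq_det_gram (EuclideanSpace.basisFun (Fin n) ℝ)
  rw [RCLike.ofReal_real_eq_id, id] at this
  rw [this]
  congr 1
  ext i j
  simp [Matrix.gram_apply, metricMatrix]

theorem continuousOn_metricMatrix {n N : ℕ} {φ : Euc n → Euc N} {V : Set (Euc n)}
    (h : ContinuousOn (fderiv ℝ φ) V) : ContinuousOn (metricMatrix φ) V :=
  continuousOn_pi.2 fun _ => continuousOn_pi.2 fun _ =>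
    (h.clm_apply continuousOn_const).inner (h.clm_apply continuousOn_const)

theorem continuousOn_normDet_fderiv {n N : ℕ} {φ : Euc n → Euc N} {V : Set (Euc n)}
    (h : ContinuousOn (fderiv ℝ φ) V) :
    ContinuousOn (fun u => (fderiv ℝ φ u).toLinearMap.normDet) V := by
  have : ∀ u, (fderiv ℝ φ u).toLinearMap.normDet = √(metricMatrix φ u).det := fun u => by
    rw [← normDet_fderiv_sq, Real.sqrt_sq (LinearMap.normDet_nonneg _)]
  simp_rw [this]
  exact Real.continuous_sqrt.comp_continuousOn
    (continuous_id.matrix_det.comp_continuousOn (continuousOn_metricMatrix h))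

theorem normDet_pos {n N : ℕ} {L : Euc n →ₗ[ℝ] Euc N} (h : Function.Injective L) :
    0 < L.normDet :=
  L.normDet_nonneg.lt_of_ne' <| (L.normDet_ne_zero_tfae.out 0 4).2 h

/-- Near `u`, distances under `φ` and under its derivative `L` at `u` agree up to a factor `K`,
which costs `K ^ n` in measure; replacing `normDet L` by the nearby values of `normDet` costs one
more factor `K`. -/
theorem eventually_euclideanHausdorffMeasure_image {n N : ℕ} {φ : Euc n → Euc N} {V : Set (Euc n)}
    (hV : IsOpen V) (hφ : ContDiffOn ℝ 1 φ V) {u : Euc n} (hu : u ∈ V)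
    (hinj : Function.Injective (fderiv ℝ φ u)) {K : ℝ≥0} (hK : 1 < K) :
    ∃ U : Set (Euc n), IsOpen U ∧ u ∈ U ∧ ∀ D ⊆ V ∩ U, MeasurableSet D →
      vol n (φ '' D) ≤ (K : ℝ≥0∞) ^ (n + 1) *
          ∫⁻ x in D, ENNReal.ofReal (fderiv ℝ φ x).toLinearMap.normDet ∧
      ∫⁻ x in D, ENNReal.ofReal (fderiv ℝ φ x).toLinearMap.normDet ≤
        (K : ℝ≥0∞) ^ (n + 1) * vol n (φ '' D) := by
  set L := fderiv ℝ φ u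
  have hr0 : 0 < L.toLinearMap.normDet := normDet_pos hinj
  have hK' : (1 : ℝ) < K := by exact_mod_cast hK
  obtain ⟨κ, hκ, hanti⟩ := L.toLinearMap.exists_antilipschitzWith (LinearMap.ker_eq_bot.2 hinj)
  obtain ⟨δ, hδ, h1, h2⟩ : ∃ δ : ℝ, 0 < δ ∧ 1 + δ ≤ K ∧ 1 ≤ K * (1 - δ) := by
    -- The second requirement amounts to `K + K⁻¹ ≥ 2`; the third is an equality.
    refine ⟨1 - (K : ℝ)⁻¹, ?_, ?_, ?_⟩
    · have := inv_lt_one_of_one_lt₀ hK'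
      linarith
    · have : 0 < (K : ℝ)⁻¹ := by positivity
      have h3 : (K : ℝ) * (K : ℝ)⁻¹ = 1 := mul_inv_cancel₀ (by positivity)
      nlinarith [sq_nonneg ((K : ℝ) - 1)]
    · rw [sub_sub_cancel, mul_inv_cancel₀ (by positivity)]
  have hst : HasStrictFDerivAt φ L u :=
    (hφ.contDiffAt (hV.mem_nhds hu)).hasStrictFDerivAt one_ne_zero
  have hcont : ContinuousAt (fun u => (fderiv ℝ φ u).toLinearMap.normDet) u :=
    (continuousOn_normDet_fderiv
      (hφ.continuousOn_fderiv_of_isOpen hV le_rfl)).continuousAt (hV.mem_nhds hu)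
  -- With this constant, the lower bound `‖a - b‖ ≤ κ ‖L a - L b‖` turns the linearization error
  -- into `δ ‖L a - L b‖`.
  obtain ⟨s, hs, happ⟩ := hst.approximates_deriv_on_nhds (c := ⟨δ, hδ.le⟩ / κ)
    (Or.inr (div_pos hδ hκ))
  have hev : ∀ᶠ x in 𝓝 u, x ∈ s ∧
      L.toLinearMap.normDet ≤ K * (fderiv ℝ φ x).toLinearMap.normDet ∧
      (fderiv ℝ φ x).toLinearMap.normDet ≤ K * L.toLinearMap.normDet := by
    refine Filter.Eventually.and hs (Filter.Eventually.and ?_ ?_)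
    · refine ((continuousAt_const.mul hcont).eventually (lt_mem_nhds ?_)).mono fun x hx => hx.le
      exact lt_mul_of_one_lt_left hr0 hK'
    · refine (hcont.eventually (gt_mem_nhds ?_)).mono fun x hx => hx.le
      exact lt_mul_of_one_lt_left hr0 hK'
  obtain ⟨U, hUs, hUo, huU⟩ := eventually_nhds_iff.1 hev
  refine ⟨U, hUo, huU, fun D hD hDm => ?_⟩
  have hdist : ∀ a ∈ D, ∀ b ∈ D,
      ‖φ a - φ b - (L a - L b)‖ ≤ δ * ‖L a - L b‖ := fun a ha b hb => by
    have h := happ a (hUs a (hD ha).2).1 b (hUs b (hD hb).2).1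
    have h' := hanti.le_mul_dist a b
    rw [dist_eq_norm, dist_eq_norm] at h'
    rw [← map_sub]
    rw [← map_sub] at h'
    refine h.trans ?_
    have : ((⟨δ, hδ.le⟩ / κ : ℝ≥0) : ℝ) = δ / κ := rfl
    rw [this, div_mul_eq_mul_div, div_le_iff₀ (by exact_mod_cast hκ)]
    calc δ * ‖a - b‖ ≤ δ * (κ * ‖L (a - b)‖) := by gcongr; exact h'
      _ = _ := by ring
  have hA : ∀ a ∈ D, ∀ b ∈ D, dist (φ a) (φ b) ≤ K * dist (L a) (L b) := fun a ha b hb => by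
    rw [dist_eq_norm, dist_eq_norm]
    have := hdist a ha b hb
    have h3 : ‖φ a - φ b‖ ≤ ‖φ a - φ b - (L a - L b)‖ + ‖L a - L b‖ := by
      simpa using norm_add_le (φ a - φ b - (L a - L b)) (L a - L b)
    nlinarith [norm_nonneg (L a - L b)]
  have hB : ∀ a ∈ D, ∀ b ∈ D, dist (L a) (L b) ≤ K * dist (φ a) (φ b) := fun a ha b hb => by
    rw [dist_eq_norm, dist_eq_norm]
    have := hdist a ha b hb
    have h3 : ‖L a - L b‖ ≤ ‖φ a - φ b‖ + ‖φ a - φ b - (L a - L b)‖ := by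
      simpa using norm_sub_le (φ a - φ b) (φ a - φ b - (L a - L b))
    have h4 : (1 - δ) * ‖L a - L b‖ ≤ ‖φ a - φ b‖ := by linarith
    nlinarith [norm_nonneg (L a - L b)]
  have hvol : Measure.euclideanHausdorffMeasure n (L '' D) =
      ENNReal.ofReal L.toLinearMap.normDet * volume D := by
    have := L.toLinearMap.euclideanHausdorffMeasure_image_eq_normDet_mul_volume D
    rwa [finrank_euclideanSpace_fin] at this
  have i1 := euclideanHausdorffMeasure_image_le_of_dist_le n hA
  have i2 := euclideanHausdorffMeasure_image_le_of_dist_le n hB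
  rw [hvol] at i1 i2
  have j1 : ENNReal.ofReal L.toLinearMap.normDet * volume D ≤
      K * ∫⁻ x in D, ENNReal.ofReal (fderiv ℝ φ x).toLinearMap.normDet := by
    rw [← setLIntegral_const, ← lintegral_const_mul' _ _ ENNReal.coe_ne_top]
    refine setLIntegral_mono' hDm fun x hx => ?_
    rw [← ENNReal.ofReal_coe_nnreal, ← ENNReal.ofReal_mul (NNReal.coe_nonneg K)]
    exact ENNReal.ofReal_le_ofReal (hUs x (hD hx).2).2.1
  have j2 : ∫⁻ x in D, ENNReal.ofReal (fderiv ℝ φ x).toLinearMap.normDet ≤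
      K * (ENNReal.ofReal L.toLinearMap.normDet * volume D) := by
    rw [← setLIntegral_const, ← lintegral_const_mul' _ _ ENNReal.coe_ne_top]
    refine setLIntegral_mono' hDm fun x hx => ?_
    rw [← ENNReal.ofReal_coe_nnreal, ← ENNReal.ofReal_mul (NNReal.coe_nonneg K)]
    exact ENNReal.ofReal_le_ofReal (hUs x (hD hx).2).2.2
  constructor
  · refine i1.trans ?_
    rw [pow_succ, mul_assoc]
    gcongr
  · refine j2.trans ?_
    rw [pow_succ', mul_assoc]
    exact mul_le_mul_right i2 _

theorem ennreal_le_of_forall_pow_mul_le {a b : ℝ≥0∞} (d : ℕ)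
    (h : ∀ K : ℝ≥0, 1 < K → a ≤ (K : ℝ≥0∞) ^ d * b) : a ≤ b := by
  by_cases hb : b = ⊤
  · simp [hb]
  have ht : Tendsto (fun K : ℝ≥0 => (K : ℝ≥0∞) ^ d * b) (𝓝[>] 1) (𝓝 ((1 : ℝ≥0) ^ d * b)) := by
    refine Tendsto.mono_left ?_ nhdsWithin_le_nhds
    refine ENNReal.Tendsto.mul_const ?_ (Or.inr hb)
    exact (ENNReal.continuous_pow d).continuousAt.tendsto.comp
      (ENNReal.continuous_coe.continuousAt)
  simpa using ge_of_tendsto ht (eventually_mem_nhdsWithin.mono fun K hK => h K hK)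

/-- The area formula for injective `C¹` immersions. -/
theorem vol_image_eq_lintegral {n N : ℕ} {φ : Euc n → Euc N} {V : Set (Euc n)}
    (hV : IsOpen V) (hφ : ContDiffOn ℝ 1 φ V) (hi : InjOn φ V)
    (himm : ∀ u ∈ V, Function.Injective (fderiv ℝ φ u)) {D : Set (Euc n)} (hD : MeasurableSet D)
    (hDV : D ⊆ V) :
    vol n (φ '' D) = ∫⁻ x in D, ENNReal.ofReal (fderiv ℝ φ x).toLinearMap.normDet := by
  -- Injectivity keeps the images measurable and disjoint, which supplies the superadditivity needed
  -- when the volume is the larger side.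
  have key : ∀ t : ℕ → Set (Euc n), (∀ i, MeasurableSet (t i)) →
      Pairwise (Function.onFun Disjoint t) → (∀ i, t i ⊆ D) →
      vol n (φ '' ⋃ i, t i) = ∑' i, vol n (φ '' t i) := fun t ht hd hs => by
    rw [image_iUnion]
    refine measure_iUnion (fun i j hij => ?_) fun i => (ht i).image_of_continuousOn_injOn
      (hφ.continuousOn.mono ((hs i).trans hDV)) (hi.mono ((hs i).trans hDV))
    exact disjoint_image_image fun a ha b hb hab => (hd hij).ne_of_mem ha hb
      (hi (hDV (hs i ha)) (hDV (hs j hb)) hab)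
  refine le_antisymm (ennreal_le_of_forall_pow_mul_le (n + 1) fun K hK => ?_)
    (ennreal_le_of_forall_pow_mul_le (n + 1) fun K hK => ?_)
  · refine le_of_forall_exists_open_le (fun D => vol n (φ '' D)) (fun D => (K : ℝ≥0∞) ^ (n + 1) *
      ∫⁻ x in D, ENNReal.ofReal (fderiv ℝ φ x).toLinearMap.normDet) hD (by simp [vol]) (fun t => ?_)
      (fun t ht hd _ => ?_) fun x hx => ?_
    · rw [image_iUnion]
      exact measure_iUnion_le _
    · rw [ENNReal.tsum_mul_left, lintegral_iUnion ht hd]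
    · obtain ⟨U, hU, hxU, h⟩ :=
        eventually_euclideanHausdorffMeasure_image hV hφ (hDV hx) (himm x (hDV hx)) hK
      exact ⟨U, hU, hxU, fun A hA hAm => (h A (hA.trans (inter_subset_inter_left _ hDV)) hAm).1⟩
  · refine le_of_forall_exists_open_le
      (fun D => ∫⁻ x in D, ENNReal.ofReal (fderiv ℝ φ x).toLinearMap.normDet)
      (fun D => (K : ℝ≥0∞) ^ (n + 1) * vol n (φ '' D)) hD (by simp) (fun t => ?_)
      (fun t ht hd hs => ?_) fun x hx => ?_
    · exact lintegral_iUnion_le _ _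
    · rw [ENNReal.tsum_mul_left, key t ht hd hs]
    · obtain ⟨U, hU, hxU, h⟩ :=
        eventually_euclideanHausdorffMeasure_image hV hφ (hDV hx) (himm x (hDV hx)) hK
      exact ⟨U, hU, hxU, fun A hA hAm => (h A (hA.trans (inter_subset_inter_left _ hDV)) hAm).2⟩

/-! ### The determinant inequality and its equality case. -/

/-- The inequality of arithmetic and geometric means, with its equality case. -/
theorem prod_le_pow_card_of_sum_eq {ι : Type*} [Fintype ι] {l : ι → ℝ} {s : ℝ}
    (h0 : ∀ i, 0 ≤ l i) (hs : 0 < s) (hsum : ∑ i, l i = Fintype.card ι * s) :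
    ∏ i, l i ≤ s ^ Fintype.card ι ∧
      ((∃ i, l i ≠ s) → ∏ i, l i < s ^ Fintype.card ι) := by
  -- Tangent line bound `t ≤ exp (t - 1)` at `t = l i / s`; the exponents sum to zero, so the right
  -- sides multiply to a power of `s`.
  have hle : ∀ i, l i ≤ s * Real.exp (l i / s - 1) := fun i => by
    have := Real.add_one_le_exp (l i / s - 1)
    rw [sub_add_cancel, div_le_iff₀ hs] at this
    linarith
  have hprod : ∏ i, s * Real.exp (l i / s - 1) = s ^ Fintype.card ι := by
    rw [Finset.prod_mul_distrib, ← Real.exp_sum, Finset.sum_sub_distrib, ← Finset.sum_div, hsum]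
    simp [hs.ne']
  refine ⟨(Finset.prod_le_prod (fun i _ => h0 i) fun i _ => hle i).trans_eq hprod, ?_⟩
  rintro ⟨i, hi⟩
  -- The strict comparison of products needs positive factors; a zero factor makes the claim
  -- immediate.
  by_cases hz : ∃ j, l j = 0
  · obtain ⟨j, hj⟩ := hz
    rw [Finset.prod_eq_zero (Finset.mem_univ j) hj]
    positivity
  · push Not at hz
    refine (Finset.prod_lt_prod (fun j _ => (h0 j).lt_of_ne' (hz j)) (fun j _ => hle j)
      ⟨i, Finset.mem_univ i, ?_⟩).trans_eq hprod
    have := Real.add_one_lt_exp (x := l i / s - 1) (by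
      rw [sub_ne_zero, Ne, div_eq_one_iff_eq hs.ne']
      exact hi)
    rw [sub_add_cancel, div_lt_iff₀ hs] at this
    linarith

open scoped MatrixOrder Matrix.Norms.L2Operator in
theorem exists_eq_transpose_mul_self {n : ℕ} {g : Matrix (Fin n) (Fin n) ℝ} (hg : g.PosDef) :
    ∃ R : Matrix (Fin n) (Fin n) ℝ, g = star R * R :=
  CStarAlgebra.nonneg_iff_eq_star_mul_self.1 hg.posSemidef.nonneg

/-- Factoring `g = Rᵀ R` replaces `B` by `K = R⁻ᵀ B R⁻¹`, which is still positive semidefinite, has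
trace `n s`, and satisfies `det B = det K * det g`. The arithmetic-geometric mean inequality for the
eigenvalues of `K` concludes; in the equality case all of them are `s`, so `K = s • 1` and `B = s •
g`. -/
theorem det_le_of_trace_inv_mul_eq {n : ℕ} (hn : 1 ≤ n) {g B : Matrix (Fin n) (Fin n) ℝ}
    (hg : g.PosDef) (hB : B.PosSemidef) {s : ℝ} (htr : (g⁻¹ * B).trace = n * s) :
    0 ≤ s ∧ B.det ≤ s ^ n * g.det ∧ (0 < s → B ≠ s • g → B.det < s ^ n * g.det) := by
  obtain ⟨R, hR⟩ := exists_eq_transpose_mul_self hg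
  have hRu : IsUnit R := by
    have h := hg.isUnit
    rw [Matrix.isUnit_iff_isUnit_det, hR, Matrix.det_mul] at h
    exact (Matrix.isUnit_iff_isUnit_det _).2 (isUnit_of_mul_isUnit_right h)
  have hRd : IsUnit R.det := (Matrix.isUnit_iff_isUnit_det _).1 hRu
  set K := (R⁻¹).conjTranspose * B * R⁻¹ with hKdef
  have hK : K.PosSemidef := hB.conjTranspose_mul_mul_same _
  have hBK : B = star R * K * R := by
    have h1 : star R * (R⁻¹).conjTranspose = 1 := by
      rw [Matrix.star_eq_conjTranspose, ← Matrix.conjTranspose_mul, Matrix.nonsing_inv_mul _ hRd,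
        Matrix.conjTranspose_one]
    calc B = (star R * (R⁻¹).conjTranspose) * B * (R⁻¹ * R) := by
          rw [h1, Matrix.nonsing_inv_mul _ hRd, one_mul, mul_one]
      _ = _ := by simp only [hKdef, mul_assoc]
  have hdet : B.det = K.det * g.det := by
    have h := congrArg Matrix.det hBK
    rw [Matrix.det_mul, Matrix.det_mul] at h
    rw [h, hR, Matrix.det_mul (star R) R]
    ring
  have htrK : K.trace = n * s := by
    rw [← htr, hR, Matrix.mul_inv_rev, hKdef, Matrix.trace_mul_comm, ← mul_assoc,
      Matrix.star_eq_conjTranspose, Matrix.conjTranspose_nonsing_inv]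
  have hgpos : 0 < g.det := hg.det_pos
  have heig := hK.isHermitian.trace_eq_sum_eigenvalues
  have heigd := hK.isHermitian.det_eq_prod_eigenvalues
  simp only [RCLike.ofReal_real_eq_id, id] at heig heigd
  have hn0 : (0 : ℝ) < n := by exact_mod_cast hn
  have hs0 : 0 ≤ s := by
    have := hK.trace_nonneg
    rw [htrK] at this
    exact nonneg_of_mul_nonneg_right this hn0
  refine ⟨hs0, ?_⟩
  rcases hs0.eq_or_lt with rfl | hs
  · refine ⟨?_, fun h => (lt_irrefl _ h).elim⟩
    have hK0 : ∀ i, hK.isHermitian.eigenvalues i = 0 := fun i => by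
      rw [htrK, mul_zero, eq_comm, Finset.sum_eq_zero_iff_of_nonneg
        fun i _ => hK.eigenvalues_nonneg i] at heig
      exact heig i (Finset.mem_univ i)
    rw [hdet, heigd, Finset.prod_eq_zero (Finset.mem_univ ⟨0, hn⟩) (hK0 _), zero_mul]
    positivity
  · obtain ⟨h1, h2⟩ := prod_le_pow_card_of_sum_eq (fun i => hK.eigenvalues_nonneg i) hs
      (by rw [← heig, htrK, Fintype.card_fin])
    rw [Fintype.card_fin, ← heigd] at h1 h2
    rw [hdet]
    refine ⟨mul_le_mul_of_nonneg_right h1 hgpos.le, fun _ hne =>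
      mul_lt_mul_of_pos_right (h2 ?_) hgpos⟩
    by_contra hcon
    push Not at hcon
    refine hne ?_
    have hKs : K = s • 1 := by
      have h3 := hK.isHermitian.spectral_theorem
      have h4 : Matrix.diagonal (RCLike.ofReal ∘ hK.isHermitian.eigenvalues) =
          s • (1 : Matrix (Fin n) (Fin n) ℝ) := by
        rw [← Matrix.diagonal_one, ← Matrix.diagonal_smul]
        congr 1
        ext i
        simp [hcon i]
      rw [h4, map_smul, map_one] at h3
      exact h3
    rw [hBK, hKs, hR]
    simp

theorem isClosed_posSemidef (n : ℕ) : IsClosed {M : Matrix (Fin n) (Fin n) ℝ | M.PosSemidef} := by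
  simp_rw [Matrix.posSemidef_iff_dotProduct_mulVec, ofPred_and, ofPred_forall]
  refine IsClosed.inter ?_ (isClosed_iInter fun x => ?_)
  · exact isClosed_eq (continuous_id.matrix_conjTranspose) continuous_id
  · exact isClosed_le continuous_const
      (continuous_const.dotProduct (continuous_id.matrix_mulVec continuous_const))

/-! ### Local orthonormal normal frames. -/

/-- `ν` is a `C¹` orthonormal frame, over `V`, of the normal spaces in `ℝ^{n+m+1}` of the
submanifold of the unit sphere parametrized by `φ`, the first member of which is `φ` itself. -/
structure IsNormalFrame {n m : ℕ} (V : Set (Euc n)) (φ : Euc n → Euc (n + m + 1))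
    (ν : Fin (m + 1) → Euc n → Euc (n + m + 1)) : Prop where
  contDiffOn : ∀ j, ContDiffOn ℝ 1 (ν j) V
  orthonormal : ∀ u ∈ V, Orthonormal ℝ fun j => ν j u
  inner_fderiv : ∀ u ∈ V, ∀ a j, ⟪fderiv ℝ φ u a, ν j u⟫_ℝ = 0
  zero : ∀ u ∈ V, ν 0 u = φ u

theorem two_le_infty : (2 : WithTop ℕ∞) ≤ ((⊤ : ℕ∞) : WithTop ℕ∞) :=
  WithTop.coe_le_coe.2 le_top

theorem IsNormalFrame.mono {n m : ℕ} {V V' : Set (Euc n)} {φ : Euc n → Euc (n + m + 1)}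
    {ν : Fin (m + 1) → Euc n → Euc (n + m + 1)} (h : IsNormalFrame V φ ν) (hsub : V' ⊆ V) :
    IsNormalFrame V' φ ν where
  contDiffOn j := (h.contDiffOn j).mono hsub
  orthonormal u hu := h.orthonormal u (hsub hu)
  inner_fderiv u hu := h.inner_fderiv u (hsub hu)
  zero u hu := h.zero u (hsub hu)

/-- Induction on the index: each step divides only by squared norms of earlier vectors, nonzero by
linear independence at `u`. -/
theorem contDiffAt_gramSchmidt {E F : Type*} [NormedAddCommGroup E] [NormedSpace ℝ E]
    [NormedAddCommGroup F] [InnerProductSpace ℝ F] {N : ℕ} {k : WithTop ℕ∞}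
    {f : Fin N → E → F} {u : E} (hf : ∀ i, ContDiffAt ℝ k (f i) u)
    (h : LinearIndependent ℝ fun i => f i u) (i : Fin N) :
    ContDiffAt ℝ k (fun v => InnerProductSpace.gramSchmidt ℝ (fun i => f i v) i) u := by
  induction i using WellFoundedLT.induction with
  | ind i ih =>
    have he : (fun v => InnerProductSpace.gramSchmidt ℝ (fun i => f i v) i) = fun v =>
        f i v - ∑ j ∈ Finset.Iio i,
          (⟪InnerProductSpace.gramSchmidt ℝ (fun i => f i v) j, f i v⟫_ℝ /
            (‖InnerProductSpace.gramSchmidt ℝ (fun i => f i v) j‖ ^ 2 : ℝ)) •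
              InnerProductSpace.gramSchmidt ℝ (fun i => f i v) j := by
      funext v
      rw [InnerProductSpace.gramSchmidt_def]
      simp only [Submodule.starProjection_singleton, RCLike.ofReal_real_eq_id, id]
    rw [he]
    refine (hf i).sub (ContDiffAt.sum fun j hj => ?_)
    have hj' := ih j (Finset.mem_Iio.1 hj)
    refine ContDiffAt.smul (ContDiffAt.div (hj'.inner ℝ (hf i)) ?_ ?_) hj'
    · simpa using hj'.norm_sq ℝ
    · simpa using InnerProductSpace.gramSchmidt_ne_zero j h

theorem contDiffAt_gramSchmidtNormed {E F : Type*} [NormedAddCommGroup E] [NormedSpace ℝ E]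
    [NormedAddCommGroup F] [InnerProductSpace ℝ F] {N : ℕ} {k : WithTop ℕ∞}
    {f : Fin N → E → F} {u : E} (hf : ∀ i, ContDiffAt ℝ k (f i) u)
    (h : LinearIndependent ℝ fun i => f i u) (i : Fin N) :
    ContDiffAt ℝ k (fun v => InnerProductSpace.gramSchmidtNormed ℝ (fun i => f i v) i) u := by
  have h0 := InnerProductSpace.gramSchmidt_ne_zero i h
  have h1 := contDiffAt_gramSchmidt hf h i
  exact ((h1.norm ℝ h0).inv (norm_ne_zero_iff.2 h0)).smul h1

theorem inner_fderiv_eq_zero_of_norm_eq_one {n N : ℕ} {φ : Euc n → Euc N} {V : Set (Euc n)}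
    (hV : IsOpen V) (hφ : DifferentiableOn ℝ φ V) (h1 : ∀ u ∈ V, ‖φ u‖ = 1) {u : Euc n}
    (hu : u ∈ V) (a : Euc n) : ⟪fderiv ℝ φ u a, φ u⟫_ℝ = 0 := by
  have hd := (hφ u hu).differentiableAt (hV.mem_nhds hu)
  have he : (fun v => ⟪φ v, φ v⟫_ℝ) =ᶠ[𝓝 u] fun _ => 1 := by
    filter_upwards [hV.mem_nhds hu] with v hv
    rw [real_inner_self_eq_norm_sq, h1 v hv, one_pow]
  have h2 := he.fderiv_eq (𝕜 := ℝ)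
  have h3 := congrArg (fun L => L a) h2
  rw [fderiv_fun_const] at h3
  simp only [fderiv_inner_apply ℝ hd hd] at h3
  rw [real_inner_comm] at h3
  simpa using h3

theorem finrank_range_fderiv {n N : ℕ} {L : Euc n →L[ℝ] Euc N} (h : Function.Injective L) :
    Module.finrank ℝ (LinearMap.range L.toLinearMap) = n := by
  rw [LinearMap.finrank_range_of_inj h, finrank_euclideanSpace_fin]

/-- At `u₀`, complete `φ u₀` to an orthonormal basis of the orthogonal complement of the tangent
space. The coordinate tangent vectors, `φ`, and the remaining basis vectors held constant stay
independent near `u₀`, and Gram–Schmidt applied in this order makes the last vectors orthogonal to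
the tangent space and to `φ`. -/
theorem exists_isNormalFrame {n m : ℕ} {V : Set (Euc n)} {φ : Euc n → Euc (n + m + 1)}
    (hV : IsOpen V) (hφ : ContDiffOn ℝ ∞ φ V) (himm : ∀ u ∈ V, Function.Injective (fderiv ℝ φ u))
    (h1 : ∀ u ∈ V, ‖φ u‖ = 1) {u₀ : Euc n} (hu₀ : u₀ ∈ V) :
    ∃ V' ⊆ V, IsOpen V' ∧ u₀ ∈ V' ∧ ∃ ν : Fin (m + 1) → Euc n → Euc (n + m + 1),
      IsNormalFrame V' φ ν := by
  have hperp := fun u (hu : u ∈ V) => inner_fderiv_eq_zero_of_norm_eq_one hV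
    (hφ.differentiableOn (by simp)) h1 hu
  set T := LinearMap.range (fderiv ℝ φ u₀).toLinearMap with hT
  have hTr : Module.finrank ℝ T = n := finrank_range_fderiv (himm u₀ hu₀)
  have hTo : Module.finrank ℝ Tᗮ = m + 1 := by
    have := T.finrank_add_finrank_orthogonal
    rw [hTr, finrank_euclideanSpace_fin] at this
    omega
  have hmem : φ u₀ ∈ Tᗮ := by
    rw [Submodule.mem_orthogonal]
    rintro _ ⟨a, rfl⟩
    exact hperp u₀ hu₀ a
  obtain ⟨b, hb⟩ := Orthonormal.exists_orthonormalBasis_extension_of_card_eq (𝕜 := ℝ) (E := Tᗮ)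
    (ι := Fin (m + 1)) (by rw [hTo, Fintype.card_fin]) (v := fun _ => ⟨φ u₀, hmem⟩) (s := {0}) (by
      refine ⟨fun i => ?_, fun i j hij => (hij (Subsingleton.elim _ _)).elim⟩
      simpa using h1 u₀ hu₀)
  let f : Fin (n + (m + 1)) → Euc n → Euc (n + m + 1) :=
    Fin.addCases (fun i u => fderiv ℝ φ u (EuclideanSpace.single i 1))
      (fun j u => if j = 0 then φ u else b j)
  have hf : ∀ i, ContDiffOn ℝ 1 (f i) V := by
    refine Fin.addCases (fun i => ?_) (fun j => ?_)
    · simp only [f, Fin.addCases_left]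
      exact ((hφ.of_le (m := 2) two_le_infty).fderiv_of_isOpen hV (m := 1)
        (by norm_num)).clm_apply
        contDiffOn_const
    · simp only [f, Fin.addCases_right]
      by_cases hj : j = 0
      · simp only [hj, if_true]
        exact hφ.of_le (by exact_mod_cast le_top)
      · simp only [hj, if_false]
        exact contDiffOn_const
  have hli : LinearIndependent ℝ fun i => f i u₀ := by
    have hsum : LinearIndependent ℝ (Sum.elim
        (fun i : Fin n => fderiv ℝ φ u₀ (EuclideanSpace.single i 1))
        (fun j : Fin (m + 1) => (b j : Euc (n + m + 1)))) := by
      refine LinearIndependent.sum_type ?_ ?_ ?_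
      · have := ((EuclideanSpace.basisFun (Fin n) ℝ).toBasis.linearIndependent.map'
          (fderiv ℝ φ u₀).toLinearMap (LinearMap.ker_eq_bot.2 (himm u₀ hu₀)))
        convert this using 1
        ext i
        simp
      · have := b.toBasis.linearIndependent.map' Tᗮ.subtype (Submodule.ker_subtype _)
        rw [OrthonormalBasis.coe_toBasis] at this
        exact this
      · refine T.orthogonal_disjoint.mono ?_ ?_
        · rw [Submodule.span_le]
          rintro _ ⟨i, rfl⟩
          exact ⟨_, rfl⟩
        · rw [Submodule.span_le]
          rintro _ ⟨j, rfl⟩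
          exact (b j).2
    have h2 := hsum.comp _ (finSumFinEquiv (m := n) (n := m + 1)).symm.injective
    convert h2 using 1
    ext1 i
    induction i using Fin.addCases with
    | left i => simp [f]
    | right j =>
      by_cases hj : j = 0
      · subst hj
        simp [f, hb 0 rfl]
      · simp [f, hj]
  let V' := V ∩ (fun u i => f i u) ⁻¹' {g | LinearIndependent ℝ g}
  have hV' : IsOpen V' := (continuousOn_pi.2 fun i => (hf i).continuousOn).isOpen_inter_preimage hV
    isOpen_setOfPred_linearIndependent
  -- The first member is `φ` itself, which is already a unit normal; the others are orthogonal to it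
  -- because `φ` precedes them in the orthogonalized family.
  let ν : Fin (m + 1) → Euc n → Euc (n + m + 1) := fun j u =>
    if j = 0 then φ u else InnerProductSpace.gramSchmidtNormed ℝ (fun i => f i u) (Fin.natAdd n j)
  have htri : ∀ u j i, i < Fin.natAdd n j →
      ⟪InnerProductSpace.gramSchmidtNormed ℝ (fun i => f i u) (Fin.natAdd n j), f i u⟫_ℝ = 0 := by
    intro u j i hi
    rw [InnerProductSpace.gramSchmidtNormed, inner_smul_left,
      InnerProductSpace.gramSchmidt_inv_triangular ℝ _ hi, mul_zero]
  have hzero : ∀ u (j : Fin (m + 1)), j ≠ 0 →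
      ⟪InnerProductSpace.gramSchmidtNormed ℝ (fun i => f i u) (Fin.natAdd n j), φ u⟫_ℝ = 0 := by
    intro u j hj
    have hj' : (j : ℕ) ≠ 0 := fun h => hj (Fin.ext h)
    have h := htri u j (Fin.natAdd n 0) (by
      change n + 0 < n + (j : ℕ)
      omega)
    simpa [f] using h
  refine ⟨V', inter_subset_left, hV', ⟨hu₀, hli⟩, ν, ?_, ?_, ?_, ?_⟩
  · intro j
    by_cases hj : j = 0
    · simp only [ν, hj, if_true]
      exact (hφ.of_le (by exact_mod_cast le_top)).mono inter_subset_left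
    · simp only [ν, hj, if_false]
      intro u hu
      exact (contDiffAt_gramSchmidtNormed
        (fun i => (hf i).contDiffAt (hV.mem_nhds hu.1)) hu.2 _).contDiffWithinAt
  · intro u hu
    have ho := InnerProductSpace.gramSchmidtNormed_orthonormal (𝕜 := ℝ) hu.2
    refine ⟨fun j => ?_, fun j k hjk => ?_⟩
    · by_cases hj : j = 0
      · simp only [ν, hj, if_true]
        exact h1 u hu.1
      · simp only [ν, hj, if_false]
        exact ho.1 _
    · by_cases hj : j = 0
      · have hk : k ≠ 0 := fun h => hjk (hj.trans h.symm)
        simp only [ν, hj, hk, if_true, if_false]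
        rw [real_inner_comm]
        exact hzero u k hk
      · by_cases hk : k = 0
        · simp only [ν, hj, hk, if_true, if_false]
          exact hzero u j hj
        · simp only [ν, hj, hk, if_false]
          exact ho.2 fun h => hjk (by simpa using h)
  · intro u hu a j
    by_cases hj : j = 0
    · simp only [ν, hj, if_true]
      exact hperp u hu.1 a
    · simp only [ν, hj, if_false]
      have ha : a = ∑ i, a i • EuclideanSpace.single i (1 : ℝ) := by
        simpa using ((EuclideanSpace.basisFun (Fin n) ℝ).sum_repr a).symm
      rw [ha, map_sum, sum_inner]
      refine Finset.sum_eq_zero fun i _ => ?_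
      have h := htri u j (Fin.castAdd (m + 1) i) (by simp [Fin.lt_def]; omega)
      simp only [f, Fin.addCases_left] at h
      rw [map_smul, inner_smul_left, real_inner_comm]
      simp only [f]
      rw [h, mul_zero]
  · intro u _
    simp [ν]

theorem IsLocalParam.injOn {n N : ℕ} {S : Set (Euc N)} {V : Set (Euc n)} {φ : Euc n → Euc N}
    (h : IsLocalParam S V φ) : InjOn φ V :=
  injOn_iff_injective.2 h.embedding.injective

theorem IsLocalParam.image_subset {n N : ℕ} {S : Set (Euc N)} {V : Set (Euc n)}
    {φ : Euc n → Euc N} (h : IsLocalParam S V φ) : φ '' V ⊆ S := by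
  obtain ⟨U, -, hU⟩ := h.isOpen_image
  rw [hU]
  exact inter_subset_left

theorem IsLocalParam.exists_isOpen_image_eq {n N : ℕ} {S : Set (Euc N)} {V V' : Set (Euc n)}
    {φ : Euc n → Euc N} (h : IsLocalParam S V φ) (hV' : IsOpen V') (hsub : V' ⊆ V) :
    ∃ U : Set (Euc N), IsOpen U ∧ φ '' V' = S ∩ U := by
  obtain ⟨U, hU, hUe⟩ := h.isOpen_image
  obtain ⟨O, hO, hOe⟩ := h.embedding.isInducing.isOpen_iff.1
    (hV'.preimage (continuous_subtype_val (p := (· ∈ V))))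
  refine ⟨U ∩ O, hU.inter hO, ?_⟩
  rw [← inter_assoc, ← hUe]
  ext y
  constructor
  · rintro ⟨v, hv, rfl⟩
    have : (⟨v, hsub hv⟩ : V) ∈ V.domRestrict φ ⁻¹' O := by
      rw [hOe]
      exact hv
    exact ⟨⟨v, hsub hv, rfl⟩, this⟩
  · rintro ⟨⟨v, hv, rfl⟩, hvO⟩
    have : (⟨v, hv⟩ : V) ∈ V.domRestrict φ ⁻¹' O := hvO
    rw [hOe] at this
    exact ⟨v, this, rfl⟩

theorem IsLocalParam.mono {n N : ℕ} {S : Set (Euc N)} {V V' : Set (Euc n)}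
    {φ : Euc n → Euc N} (h : IsLocalParam S V φ) (hV' : IsOpen V') (hsub : V' ⊆ V) :
    IsLocalParam S V' φ where
  isOpen_source := hV'
  smooth := h.smooth.mono hsub
  immersion u hu := h.immersion u (hsub hu)
  embedding := h.embedding.comp (Topology.IsEmbedding.inclusion hsub)
  isOpen_image := h.exists_isOpen_image_eq hV' hsub

/-- Each point of a submanifold of the sphere lies in the image of a local parametrization that
admits a normal frame. -/
theorem exists_isLocalParam_isNormalFrame {n m : ℕ} {S : Set (Euc (n + m + 1))}
    (hS : IsSubmanifold n S) (hs : S ⊆ unitSphere (n + m)) {x : Euc (n + m + 1)} (hx : x ∈ S) :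
    ∃ (V : Set (Euc n)) (φ : Euc n → Euc (n + m + 1))
      (ν : Fin (m + 1) → Euc n → Euc (n + m + 1)),
      IsLocalParam S V φ ∧ IsNormalFrame V φ ν ∧ x ∈ φ '' V := by
  obtain ⟨V, φ, h, u, hu, rfl⟩ := hS x hx
  obtain ⟨V', hsub, hV', hu', ν, hν⟩ := exists_isNormalFrame (m := m) h.isOpen_source h.smooth
    h.immersion (fun v hv => by simpa [unitSphere] using hs (h.image_subset ⟨v, hv, rfl⟩)) hu
  exact ⟨V', φ, ν, h.mono hV' hsub, hν, u, hu', rfl⟩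

/-! ### The normal exponential map and Hessians of height functions. -/

/-- The normal exponential map of `ℝ^{n+m+1}` in a normal frame. -/
noncomputable def normalMap {n m : ℕ} (ν : Fin (m + 1) → Euc n → Euc (n + m + 1))
    (z : Euc n × Euc (m + 1)) : Euc (n + m + 1) :=
  ∑ j, z.2 j • ν j z.1

/-- The matrix of minus the Hessian of the height function `⟨p, φ⟩`. -/
noncomputable def heightHess {n N : ℕ} (φ : Euc n → Euc N) (p : Euc N) (u : Euc n) :
    Matrix (Fin n) (Fin n) ℝ :=
  Matrix.of fun i k =>
    -⟪p, fderiv ℝ (fderiv ℝ φ) u (EuclideanSpace.single i 1) (EuclideanSpace.single k 1)⟫_ℝ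

theorem contDiffOn_fderiv {n N : ℕ} {φ : Euc n → Euc N} {V : Set (Euc n)} (hV : IsOpen V)
    (hφ : ContDiffOn ℝ ((⊤ : ℕ∞) : WithTop ℕ∞) φ V) : ContDiffOn ℝ 1 (fderiv ℝ φ) V :=
  (hφ.of_le two_le_infty).fderiv_of_isOpen hV (by norm_num)

theorem differentiableAt_fderiv {n N : ℕ} {φ : Euc n → Euc N} {V : Set (Euc n)} (hV : IsOpen V)
    (hφ : ContDiffOn ℝ ((⊤ : ℕ∞) : WithTop ℕ∞) φ V) {u : Euc n} (hu : u ∈ V) :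
    DifferentiableAt ℝ (fderiv ℝ φ) u :=
  ((contDiffOn_fderiv hV hφ).contDiffAt (hV.mem_nhds hu)).differentiableAt one_ne_zero

theorem fderiv_fderiv_symm {n N : ℕ} {φ : Euc n → Euc N} {V : Set (Euc n)} (hV : IsOpen V)
    (hφ : ContDiffOn ℝ ((⊤ : ℕ∞) : WithTop ℕ∞) φ V) {u : Euc n} (hu : u ∈ V) (a b : Euc n) :
    fderiv ℝ (fderiv ℝ φ) u a b = fderiv ℝ (fderiv ℝ φ) u b a := by
  refine (ContDiffAt.isSymmSndFDerivAt (n := 2) ?_ (by simp)) a b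
  exact (hφ.contDiffAt (hV.mem_nhds hu)).of_le two_le_infty

theorem heightHess_isHermitian {n N : ℕ} {φ : Euc n → Euc N} {V : Set (Euc n)} (hV : IsOpen V)
    (hφ : ContDiffOn ℝ ((⊤ : ℕ∞) : WithTop ℕ∞) φ V) {u : Euc n} (hu : u ∈ V) (p : Euc N) :
    (heightHess φ p u).IsHermitian := by
  ext i k
  simp [heightHess, fderiv_fderiv_symm hV hφ hu (EuclideanSpace.single k 1)]

theorem inner_fderiv_eq_zero_of_isMaxOn {n N : ℕ} {φ : Euc n → Euc N} {V : Set (Euc n)}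
    (hV : IsOpen V) (hφ : DifferentiableOn ℝ φ V) {u : Euc n} (hu : u ∈ V) {p : Euc N}
    (hmax : ∀ v ∈ V, ⟪p, φ v⟫_ℝ ≤ ⟪p, φ u⟫_ℝ) (a : Euc n) : ⟪p, fderiv ℝ φ u a⟫_ℝ = 0 := by
  have hd := (hφ u hu).differentiableAt (hV.mem_nhds hu)
  have hloc : IsLocalMax (fun v => ⟪p, φ v⟫_ℝ) u := by
    filter_upwards [hV.mem_nhds hu] with v hv using hmax v hv
  have h := congrArg (fun L => L a) hloc.fderiv_eq_zero
  simpa [fderiv_inner_apply ℝ (differentiableAt_const p) hd] using h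

/-- Restrict to the line `u + t a`. A positive second derivative would make `0` a local minimum as
well as a maximum, so the restriction would be locally constant with zero second derivative. -/
theorem inner_fderiv_fderiv_nonpos_of_isMaxOn {n N : ℕ} {φ : Euc n → Euc N} {V : Set (Euc n)}
    (hV : IsOpen V) (hφ : ContDiffOn ℝ ((⊤ : ℕ∞) : WithTop ℕ∞) φ V) {u : Euc n} (hu : u ∈ V)
    {p : Euc N} (hmax : ∀ v ∈ V, ⟪p, φ v⟫_ℝ ≤ ⟪p, φ u⟫_ℝ) (a : Euc n) :
    ⟪p, fderiv ℝ (fderiv ℝ φ) u a a⟫_ℝ ≤ 0 := by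
  by_contra! hpos
  let γ : ℝ → Euc n := fun t => u + t • a
  have hγ : ∀ t, HasDerivAt γ a t := fun t => by
    simpa [γ, Function.comp_def] using ((hasDerivAt_id' t).smul_const a).const_add u
  have hγ0 : γ 0 = u := by simp [γ]
  have hγc : Continuous γ := by fun_prop
  have hnear : ∀ᶠ t in 𝓝 (0 : ℝ), γ t ∈ V :=
    hγc.continuousAt.eventually_mem (by rw [hγ0]; exact hV.mem_nhds hu)
  have hd1 : ∀ v ∈ V, DifferentiableAt ℝ φ v := fun v hv =>
    (hφ.contDiffAt (hV.mem_nhds hv)).differentiableAt (by simp)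
  have hder : ∀ t, γ t ∈ V →
      HasDerivAt (fun t => ⟪p, φ (γ t)⟫_ℝ) ⟪p, fderiv ℝ φ (γ t) a⟫_ℝ t := fun t ht => by
    simpa using (hasDerivAt_const t p).inner ℝ
      ((hd1 _ ht).hasFDerivAt.comp_hasDerivAt t (hγ t))
  have hder2 : HasDerivAt (fun t => ⟪p, fderiv ℝ φ (γ t) a⟫_ℝ)
      ⟪p, fderiv ℝ (fderiv ℝ φ) u a a⟫_ℝ 0 := by
    have hdd := differentiableAt_fderiv hV hφ hu
    rw [← hγ0] at hdd
    have h := (hdd.hasFDerivAt.comp_hasDerivAt 0 (hγ 0)).clm_apply (hasDerivAt_const (0 : ℝ) a)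
    simpa [hγ0] using (hasDerivAt_const (0 : ℝ) p).inner ℝ h
  have hev : deriv (fun t => ⟪p, φ (γ t)⟫_ℝ) =ᶠ[𝓝 0] fun t => ⟪p, fderiv ℝ φ (γ t) a⟫_ℝ :=
    hnear.mono fun t ht => (hder t ht).deriv
  have h2 : deriv (deriv fun t => ⟪p, φ (γ t)⟫_ℝ) 0 = ⟪p, fderiv ℝ (fderiv ℝ φ) u a a⟫_ℝ := by
    rw [hev.deriv_eq, hder2.deriv]
  have h1 : deriv (fun t => ⟪p, φ (γ t)⟫_ℝ) 0 = 0 := by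
    rw [(hder 0 (by rwa [hγ0])).deriv, hγ0]
    exact inner_fderiv_eq_zero_of_isMaxOn hV (hφ.differentiableOn (by simp)) hu hmax a
  have hmin := isLocalMin_of_deriv_deriv_pos (by rw [h2]; exact hpos) h1
    (hder 0 (by rwa [hγ0])).continuousAt
  have hconst : (fun t => ⟪p, φ (γ t)⟫_ℝ) =ᶠ[𝓝 0] fun _ => ⟪p, φ u⟫_ℝ := by
    filter_upwards [hmin, hnear] with t ht htV
    rw [hγ0] at ht
    exact le_antisymm (hmax _ htV) ht
  have h3 := hconst.deriv.deriv_eq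
  rw [h2] at h3
  simp only [deriv_const', deriv_const] at h3
  exact hpos.ne' h3

theorem sum_smul_single {n : ℕ} (a : Euc n) : ∑ i, a i • EuclideanSpace.single i (1 : ℝ) = a := by
  simpa using (EuclideanSpace.basisFun (Fin n) ℝ).sum_repr a

theorem heightHess_posSemidef_of_isMaxOn {n N : ℕ} {φ : Euc n → Euc N} {V : Set (Euc n)}
    (hV : IsOpen V) (hφ : ContDiffOn ℝ ((⊤ : ℕ∞) : WithTop ℕ∞) φ V) {u : Euc n} (hu : u ∈ V)
    {p : Euc N} (hmax : ∀ v ∈ V, ⟪p, φ v⟫_ℝ ≤ ⟪p, φ u⟫_ℝ) : (heightHess φ p u).PosSemidef := by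
  refine Matrix.PosSemidef.of_dotProduct_mulVec_nonneg (heightHess_isHermitian hV hφ hu p)
    fun x => ?_
  have h := inner_fderiv_fderiv_nonpos_of_isMaxOn hV hφ hu hmax (WithLp.toLp 2 x)
  have he : star x ⬝ᵥ (heightHess φ p u).mulVec x =
      -⟪p, fderiv ℝ (fderiv ℝ φ) u (WithLp.toLp 2 x) (WithLp.toLp 2 x)⟫_ℝ := by
    conv_rhs => rw [← sum_smul_single (WithLp.toLp 2 x)]
    simp only [map_sum, map_smul, sum_apply, smul_apply,
      inner_sum, inner_smul_right, dotProduct, Matrix.mulVec, heightHess, Matrix.of_apply,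
      star_trivial, Finset.mul_sum, ← Finset.sum_neg_distrib]
    rw [Finset.sum_comm]
    refine Finset.sum_congr rfl fun i _ => Finset.sum_congr rfl fun k _ => ?_
    ring
  rw [he]
  linarith

theorem metricMatrix_posDef {n N : ℕ} {φ : Euc n → Euc N} {u : Euc n}
    (h : Function.Injective (fderiv ℝ φ u)) : (metricMatrix φ u).PosDef := by
  have : metricMatrix φ u =
      Matrix.gram ℝ fun i => fderiv ℝ φ u (EuclideanSpace.basisFun (Fin n) ℝ i) := by
    ext i j
    simp [Matrix.gram_apply, metricMatrix]
  rw [this]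
  refine Matrix.posDef_gram_iff_linearIndependent.2 ?_
  have := (EuclideanSpace.basisFun (Fin n) ℝ).toBasis.linearIndependent.map'
    (fderiv ℝ φ u).toLinearMap (LinearMap.ker_eq_bot.2 h)
  rw [OrthonormalBasis.coe_toBasis] at this
  exact this

namespace IsNormalFrame

variable {n m : ℕ} {V : Set (Euc n)} {φ : Euc n → Euc (n + m + 1)}
  {ν : Fin (m + 1) → Euc n → Euc (n + m + 1)}

theorem differentiableAt (hν : IsNormalFrame V φ ν) (hV : IsOpen V) (j : Fin (m + 1)) {u : Euc n}
    (hu : u ∈ V) : DifferentiableAt ℝ (ν j) u :=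
  ((hν.contDiffOn j).contDiffAt (hV.mem_nhds hu)).differentiableAt one_ne_zero

/-- Weingarten's relation, from differentiating `⟨ν_j, dφ(b)⟩ = 0`. -/
theorem inner_fderiv_fderiv (hν : IsNormalFrame V φ ν) (hV : IsOpen V)
    (hφ : ContDiffOn ℝ ((⊤ : ℕ∞) : WithTop ℕ∞) φ V) {u : Euc n} (hu : u ∈ V) (j : Fin (m + 1))
    (a b : Euc n) :
    ⟪fderiv ℝ (ν j) u a, fderiv ℝ φ u b⟫_ℝ = -⟪ν j u, fderiv ℝ (fderiv ℝ φ) u a b⟫_ℝ := by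
  have hd := hν.differentiableAt hV j hu
  have hdd := differentiableAt_fderiv hV hφ hu
  have he : (fun v => ⟪ν j v, fderiv ℝ φ v b⟫_ℝ) =ᶠ[𝓝 u] fun _ => 0 := by
    filter_upwards [hV.mem_nhds hu] with v hv
    rw [real_inner_comm]
    exact hν.inner_fderiv v hv b j
  have h3 := congrArg (fun L => L a) (he.fderiv_eq (𝕜 := ℝ))
  rw [fderiv_fun_const] at h3
  simp only [fderiv_inner_apply ℝ hd (hdd.clm_apply (differentiableAt_const b))] at h3
  rw [fderiv_clm_apply hdd (differentiableAt_const b)] at h3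
  simp at h3
  linarith

theorem hasFDerivAt_normalMap (hν : IsNormalFrame V φ ν) (hV : IsOpen V)
    {z : Euc n × Euc (m + 1)} (hz : z.1 ∈ V) :
    HasFDerivAt (normalMap ν) (∑ j, (z.2 j • (fderiv ℝ (ν j) z.1 ∘L ContinuousLinearMap.fst ℝ _ _) +
      ((EuclideanSpace.proj j : Euc (m + 1) →L[ℝ] ℝ) ∘L
        ContinuousLinearMap.snd ℝ (Euc n) (Euc (m + 1))).smulRight (ν j z.1))) z := by
  unfold normalMap
  refine HasFDerivAt.fun_sum fun j _ => ?_
  have h1 : HasFDerivAt (fun z : Euc n × Euc (m + 1) => z.2 j)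
      ((EuclideanSpace.proj j : Euc (m + 1) →L[ℝ] ℝ) ∘L
        ContinuousLinearMap.snd ℝ (Euc n) (Euc (m + 1))) z :=
    ((EuclideanSpace.proj j : Euc (m + 1) →L[ℝ] ℝ) ∘L
        ContinuousLinearMap.snd ℝ (Euc n) (Euc (m + 1))).hasFDerivAt
  have h2 : HasFDerivAt (fun z : Euc n × Euc (m + 1) => ν j z.1)
      (fderiv ℝ (ν j) z.1 ∘L ContinuousLinearMap.fst ℝ _ _) z :=
    (hν.differentiableAt hV j hz).hasFDerivAt.comp z hasFDerivAt_fst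
  exact h1.smul h2

theorem contDiffOn_normalMap (hν : IsNormalFrame V φ ν) :
    ContDiffOn ℝ 1 (normalMap ν) (V ×ˢ univ) := by
  unfold normalMap
  refine ContDiffOn.sum fun j _ => ?_
  have h1 : ContDiffOn ℝ 1 (fun z : Euc n × Euc (m + 1) => z.2 j) (V ×ˢ univ) :=
    ((EuclideanSpace.proj j : Euc (m + 1) →L[ℝ] ℝ) ∘L
        ContinuousLinearMap.snd ℝ (Euc n) (Euc (m + 1))).contDiff.contDiffOn
  have h2 : ContDiffOn ℝ 1 (fun z : Euc n × Euc (m + 1) => ν j z.1) (V ×ˢ univ) :=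
    (hν.contDiffOn j).comp contDiff_fst.contDiffOn fun z hz => hz.1
  exact h1.smul h2

theorem fderiv_normalMap_apply (hν : IsNormalFrame V φ ν) (hV : IsOpen V)
    {z : Euc n × Euc (m + 1)} (hz : z.1 ∈ V) (w : Euc n × Euc (m + 1)) :
    fderiv ℝ (normalMap ν) z w =
      ∑ j, (z.2 j • fderiv ℝ (ν j) z.1 w.1 + w.2 j • ν j z.1) := by
  rw [(hν.hasFDerivAt_normalMap hV hz).fderiv]
  simp

theorem norm_normalMap (hν : IsNormalFrame V φ ν) {z : Euc n × Euc (m + 1)} (hz : z.1 ∈ V) :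
    ‖normalMap ν z‖ = ‖z.2‖ := by
  have h : ‖normalMap ν z‖ ^ 2 = ‖z.2‖ ^ 2 := by
    rw [← real_inner_self_eq_norm_sq, normalMap, (hν.orthonormal _ hz).inner_sum,
      EuclideanSpace.norm_sq_eq]
    simp [sq]
  exact (sq_eq_sq₀ (norm_nonneg _) (norm_nonneg _)).1 h

theorem inner_normalMap (hν : IsNormalFrame V φ ν) {z : Euc n × Euc (m + 1)} (hz : z.1 ∈ V)
    (j : Fin (m + 1)) : ⟪ν j z.1, normalMap ν z⟫_ℝ = z.2 j := by
  rw [normalMap]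
  exact (hν.orthonormal _ hz).inner_right_fintype z.2 j

/-- The frame consists of `m + 1` independent vectors in the orthogonal complement of the tangent
space, which has dimension `m + 1`. -/
theorem exists_normalMap_eq (hν : IsNormalFrame V φ ν) {u : Euc n} (hu : u ∈ V)
    (hinj : Function.Injective (fderiv ℝ φ u)) {p : Euc (n + m + 1)}
    (hp : ∀ a, ⟪p, fderiv ℝ φ u a⟫_ℝ = 0) : ∃ y, normalMap ν (u, y) = p := by
  set T := LinearMap.range (fderiv ℝ φ u).toLinearMap with hT
  have hTr : Module.finrank ℝ T = n := finrank_range_fderiv hinj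
  have hTo : Module.finrank ℝ Tᗮ = m + 1 := by
    have := T.finrank_add_finrank_orthogonal
    rw [hTr, finrank_euclideanSpace_fin] at this
    omega
  have hle : Submodule.span ℝ (range fun j => ν j u) ≤ Tᗮ := by
    rw [Submodule.span_le]
    rintro _ ⟨j, rfl⟩
    rw [SetLike.mem_coe, Submodule.mem_orthogonal]
    rintro _ ⟨a, rfl⟩
    exact hν.inner_fderiv u hu a j
  have heq := Submodule.eq_of_le_of_finrank_eq hle (by
    rw [hTo, finrank_span_eq_card (hν.orthonormal u hu).linearIndependent, Fintype.card_fin])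
  have hpm : p ∈ Tᗮ := by
    rw [Submodule.mem_orthogonal]
    rintro _ ⟨a, rfl⟩
    rw [real_inner_comm]
    exact hp a
  rw [← heq, Submodule.mem_span_range_iff_exists_fun] at hpm
  obtain ⟨c, hc⟩ := hpm
  exact ⟨WithLp.toLp 2 c, by simpa [normalMap] using hc⟩

theorem sub_mem_normalSpaceAt (hν : IsNormalFrame V φ ν) {u : Euc n} (hu : u ∈ V)
    (y : Euc (m + 1)) : normalMap ν (u, y) - y 0 • φ u ∈ normalSpaceAt φ u := by
  have h00 : ⟪φ u, φ u⟫_ℝ = 1 := by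
    rw [← hν.zero u hu, real_inner_self_eq_norm_sq, (hν.orthonormal u hu).1 0, one_pow]
  rw [normalSpaceAt, ← Submodule.inf_orthogonal, Submodule.mem_inf]
  constructor
  · rw [Submodule.mem_orthogonal]
    rintro _ ⟨a, rfl⟩
    change ⟪fderiv ℝ φ u a, _⟫_ℝ = 0
    rw [inner_sub_right, normalMap, inner_sum, inner_smul_right, ← hν.zero u hu,
      hν.inner_fderiv u hu a 0, mul_zero, sub_zero]
    refine Finset.sum_eq_zero fun j _ => ?_
    rw [inner_smul_right, hν.inner_fderiv u hu a j, mul_zero]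
  · rw [Submodule.mem_orthogonal_singleton_iff_inner_right, inner_sub_right, inner_smul_right, h00]
    have := hν.inner_normalMap (z := (u, y)) hu 0
    rw [hν.zero u hu] at this
    rw [this]
    simp

/-- Split `p = y₀ φ + q`, with `q` normal in the sphere. Weingarten's relation for `ν 0 = φ` gives
`-⟨φ, D²φ⟩ = g`, and `q` sees only the normal part of `D²φ`. -/
theorem heightHess_normalMap (hν : IsNormalFrame V φ ν) (hV : IsOpen V)
    (hφ : ContDiffOn ℝ ((⊤ : ℕ∞) : WithTop ℕ∞) φ V) {u : Euc n} (hu : u ∈ V) (y : Euc (m + 1))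
    (i k : Fin n) :
    heightHess φ (normalMap ν (u, y)) u i k = y 0 * metricMatrix φ u i k -
      ⟪normalMap ν (u, y) - y 0 • φ u, secondFundForm φ u (EuclideanSpace.single i 1)
        (EuclideanSpace.single k 1)⟫_ℝ := by
  set a : Euc n := EuclideanSpace.single i 1
  set b : Euc n := EuclideanSpace.single k 1
  set q := normalMap ν (u, y) - y 0 • φ u with hq
  have h1 : ⟪q, secondFundForm φ u a b⟫_ℝ = ⟪q, fderiv ℝ (fderiv ℝ φ) u a b⟫_ℝ := by
    rw [secondFundForm, ← Submodule.inner_starProjection_left_eq_right,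
      Submodule.starProjection_eq_self_iff.2 (hν.sub_mem_normalSpaceAt hu y)]
  have h0 : fderiv ℝ (ν 0) u = fderiv ℝ φ u := by
    refine Filter.EventuallyEq.fderiv_eq ?_
    filter_upwards [hV.mem_nhds hu] with v hv using hν.zero v hv
  have h2 := hν.inner_fderiv_fderiv hV hφ hu 0 a b
  rw [h0, hν.zero u hu] at h2
  change -⟪normalMap ν (u, y), fderiv ℝ (fderiv ℝ φ) u a b⟫_ℝ =
    y 0 * ⟪fderiv ℝ φ u a, fderiv ℝ φ u b⟫_ℝ - _
  rw [h1, h2, hq, inner_sub_left, inner_smul_left, conj_trivial]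
  ring

theorem heightHess_eq_of_secondFundForm_eq_zero (hν : IsNormalFrame V φ ν) (hV : IsOpen V)
    (hφ : ContDiffOn ℝ ((⊤ : ℕ∞) : WithTop ℕ∞) φ V) {u : Euc n} (hu : u ∈ V) (y : Euc (m + 1))
    (h : ∀ a b, secondFundForm φ u a b = 0) :
    heightHess φ (normalMap ν (u, y)) u = y 0 • metricMatrix φ u := by
  ext i k
  rw [hν.heightHess_normalMap hV hφ hu, h, inner_zero_right, sub_zero]
  simp

/-- Contraction with `g⁻¹` turns the metric term into `n y₀` and the other one into a multiple of
`⟨q, H⟩`, which minimality kills. -/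
theorem trace_inv_mul_heightHess (hν : IsNormalFrame V φ ν) (hn : 1 ≤ n) (hV : IsOpen V)
    (hφ : ContDiffOn ℝ ((⊤ : ℕ∞) : WithTop ℕ∞) φ V) {u : Euc n} (hu : u ∈ V)
    (hinj : Function.Injective (fderiv ℝ φ u)) (hH : meanCurvature φ u = 0) (y : Euc (m + 1)) :
    ((metricMatrix φ u)⁻¹ * heightHess φ (normalMap ν (u, y)) u).trace = n * y 0 := by
  set q := normalMap ν (u, y) - y 0 • φ u with hq
  have hH' : ∑ i : Fin n, ∑ j : Fin n, (metricMatrix φ u)⁻¹ i j •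
      secondFundForm φ u (EuclideanSpace.single i 1) (EuclideanSpace.single j 1) = 0 := by
    rw [meanCurvature] at hH
    exact (smul_eq_zero.1 hH).resolve_left (by positivity)
  have h2 := congrArg (fun w => ⟪q, w⟫_ℝ) hH'
  simp only [inner_sum, inner_smul_right, inner_zero_right] at h2
  have hsymm : ∀ i j, heightHess φ (normalMap ν (u, y)) u j i =
      heightHess φ (normalMap ν (u, y)) u i j := fun i j =>
    (heightHess_isHermitian hV hφ hu _).apply i j
  have hmsymm : ∀ i j, metricMatrix φ u i j = metricMatrix φ u j i := fun i j =>
    real_inner_comm (fderiv ℝ φ u (EuclideanSpace.single j 1))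
      (fderiv ℝ φ u (EuclideanSpace.single i 1))
  have hone : ∑ i, ∑ j, (metricMatrix φ u)⁻¹ i j * metricMatrix φ u i j = n := by
    have h := congrArg Matrix.trace (Matrix.nonsing_inv_mul (metricMatrix φ u)
      ((Matrix.isUnit_iff_isUnit_det _).1 (metricMatrix_posDef hinj).isUnit))
    rw [Matrix.trace_one, Fintype.card_fin] at h
    rw [← h, Matrix.trace]
    refine Finset.sum_congr rfl fun i _ => ?_
    rw [Matrix.diag_apply, Matrix.mul_apply]
    exact Finset.sum_congr rfl fun j _ => by rw [hmsymm i j]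
  rw [Matrix.trace]
  calc ∑ i, ((metricMatrix φ u)⁻¹ * heightHess φ (normalMap ν (u, y)) u).diag i
      = ∑ i, ∑ j, (metricMatrix φ u)⁻¹ i j * heightHess φ (normalMap ν (u, y)) u i j := by
        refine Finset.sum_congr rfl fun i _ => ?_
        rw [Matrix.diag_apply, Matrix.mul_apply]
        exact Finset.sum_congr rfl fun j _ => by rw [hsymm i j]
    _ = y 0 * ∑ i, ∑ j, (metricMatrix φ u)⁻¹ i j * metricMatrix φ u i j -
          ∑ i, ∑ j, (metricMatrix φ u)⁻¹ i j * ⟪q, secondFundForm φ u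
            (EuclideanSpace.single i 1) (EuclideanSpace.single j 1)⟫_ℝ := by
        simp only [Finset.mul_sum, ← Finset.sum_sub_distrib]
        refine Finset.sum_congr rfl fun i _ => Finset.sum_congr rfl fun j _ => ?_
        rw [hν.heightHess_normalMap hV hφ hu]
        ring
    _ = n * y 0 := by rw [hone, h2, sub_zero, mul_comm]

end IsNormalFrame

/-! ### The Jacobian of the normal exponential map. -/

/-- The splitting of the coordinate indices of `ℝ^{n+m+1}`. -/
def sumIndex (n m : ℕ) : Fin n ⊕ Fin (m + 1) ≃ Fin (n + m + 1) := finSumFinEquiv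

/-- The standard basis of `ℝ^n × ℝ^{m+1}`. -/
noncomputable def prodBasis (n m : ℕ) : Module.Basis (Fin n ⊕ Fin (m + 1)) ℝ (Euc n × Euc (m + 1)) :=
  (EuclideanSpace.basisFun (Fin n) ℝ).toBasis.prod (EuclideanSpace.basisFun (Fin (m + 1)) ℝ).toBasis

/-- The standard basis of `ℝ^{n+m+1}`, indexed by a sum. -/
noncomputable def sumBasis (n m : ℕ) : Module.Basis (Fin n ⊕ Fin (m + 1)) ℝ (Euc (n + m + 1)) :=
  (EuclideanSpace.basisFun (Fin (n + m + 1)) ℝ).toBasis.reindex (sumIndex n m).symm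

/-- The splitting of coordinates `ℝ^{n+m+1} ≃ ℝ^n × ℝ^{m+1}`. -/
noncomputable def splitEquiv (n m : ℕ) : Euc (n + m + 1) ≃L[ℝ] Euc n × Euc (m + 1) :=
  ((sumBasis n m).repr.trans (prodBasis n m).repr.symm).toContinuousLinearEquiv

/-- Determinants are defined for endomorphisms, so the target is identified with `ℝ^n × ℝ^{m+1}` by
matching standard bases. -/
theorem det_splitEquiv_comp {n m : ℕ} (L : Euc n × Euc (m + 1) →L[ℝ] Euc (n + m + 1)) :
    ((splitEquiv n m : Euc (n + m + 1) →L[ℝ] Euc n × Euc (m + 1)) ∘L L).det =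
      (Matrix.of fun i j => L (prodBasis n m j) (sumIndex n m i)).det := by
  rw [ContinuousLinearMap.det, ← LinearMap.det_toMatrix (prodBasis n m)]
  congr 1
  ext i j
  rw [LinearMap.toMatrix_apply]
  have : ∀ w : Euc (n + m + 1), (prodBasis n m).repr (splitEquiv n m w) i =
      w (sumIndex n m i) := fun w => by
    change (prodBasis n m).repr ((prodBasis n m).repr.symm ((sumBasis n m).repr w)) i = _
    rw [LinearEquiv.apply_symm_apply]
    simp [sumBasis]
  exact this _

theorem transpose_mul_eq_inner {n m : ℕ} (v w : Fin n ⊕ Fin (m + 1) → Euc (n + m + 1)) :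
    (Matrix.of fun i j => v j (sumIndex n m i)).transpose *
      (Matrix.of fun i j => w j (sumIndex n m i)) = Matrix.of fun i j => ⟪v i, w j⟫_ℝ := by
  ext i j
  rw [Matrix.mul_apply]
  simp only [Matrix.transpose_apply, Matrix.of_apply, PiLp.inner_apply]
  rw [← (sumIndex n m).sum_comp (fun k => inner ℝ (v i k) (w j k))]
  simp [mul_comm]

namespace IsNormalFrame

variable {n m : ℕ} {V : Set (Euc n)} {φ : Euc n → Euc (n + m + 1)}
  {ν : Fin (m + 1) → Euc n → Euc (n + m + 1)}

/-- The Jacobian of the normal exponential map. -/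
theorem abs_det_mul_normDet (hν : IsNormalFrame V φ ν) (hV : IsOpen V)
    (hφ : ContDiffOn ℝ ((⊤ : ℕ∞) : WithTop ℕ∞) φ V) {z : Euc n × Euc (m + 1)} (hz : z.1 ∈ V) :
    |((splitEquiv n m : Euc (n + m + 1) →L[ℝ] Euc n × Euc (m + 1)) ∘L
      fderiv ℝ (normalMap ν) z).det| * (fderiv ℝ φ z.1).toLinearMap.normDet =
      |(heightHess φ (normalMap ν z) z.1).det| := by
  set L := fderiv ℝ (normalMap ν) z
  let v : Fin n ⊕ Fin (m + 1) → Euc (n + m + 1) :=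
    Sum.elim (fun i => fderiv ℝ φ z.1 (EuclideanSpace.single i 1)) (fun j => ν j z.1)
  set M := Matrix.of fun i j => v j (sumIndex n m i)
  have ho := orthonormal_iff_ite.1 (hν.orthonormal _ hz)
  -- The columns of `M` are the coordinate tangent vectors and the normal frame, so `Mᵀ M` is block
  -- diagonal with blocks `g` and `1`.
  have h1 : M.det ^ 2 = (metricMatrix φ z.1).det := by
    have h := congrArg Matrix.det (transpose_mul_eq_inner v v)
    rw [Matrix.det_mul, Matrix.det_transpose, ← sq] at h
    rw [h]
    have : (Matrix.of fun i j => ⟪v i, v j⟫_ℝ) =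
        Matrix.fromBlocks (metricMatrix φ z.1) 0 0 1 := by
      ext i j
      rcases i with i | i <;> rcases j with j | j
      · rfl
      · exact hν.inner_fderiv _ hz _ _
      · exact (real_inner_comm _ _).trans (hν.inner_fderiv _ hz _ _)
      · simp [v, ho, Matrix.one_apply]
    rw [this, Matrix.det_fromBlocks_zero₁₂, Matrix.det_one, mul_one]
  have h2 : |M.det| = (fderiv ℝ φ z.1).toLinearMap.normDet := by
    rw [← normDet_fderiv_sq] at h1
    rw [← abs_of_nonneg (LinearMap.normDet_nonneg (fderiv ℝ φ z.1).toLinearMap)]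
    exact sq_eq_sq_iff_abs_eq_abs _ _ |>.1 h1
  -- The product of `Mᵀ` with the matrix of `L` is block triangular: the fibre directions map to the
  -- `ν_j`, giving the block `1`, and the base directions give the Hessian block by Weingarten's
  -- relation.
  have h3 : M.det * (Matrix.of fun i j => L (prodBasis n m j) (sumIndex n m i)).det =
      (heightHess φ (normalMap ν z) z.1).det := by
    have hinr : ∀ j, L (prodBasis n m (Sum.inr j)) = ν j z.1 := fun j => by
      rw [hν.fderiv_normalMap_apply hV hz]
      simp [prodBasis]
    have h := congrArg Matrix.det (transpose_mul_eq_inner v fun j => L (prodBasis n m j))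
    rw [Matrix.det_mul, Matrix.det_transpose] at h
    rw [h]
    have : (Matrix.of fun i j => ⟪v i, L (prodBasis n m j)⟫_ℝ) =
        Matrix.fromBlocks (heightHess φ (normalMap ν z) z.1).transpose 0
          (Matrix.of fun i j => ⟪v (Sum.inr i), L (prodBasis n m (Sum.inl j))⟫_ℝ) 1 := by
      ext i j
      rcases i with i | i <;> rcases j with j | j
      · simp only [Matrix.of_apply, Matrix.fromBlocks_apply₁₁, Matrix.transpose_apply, heightHess]
        rw [hν.fderiv_normalMap_apply hV hz, inner_sum]
        conv_rhs => rw [normalMap, sum_inner, ← Finset.sum_neg_distrib]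
        refine Finset.sum_congr rfl fun k _ => ?_
        have h4 := hν.inner_fderiv_fderiv hV hφ hz k (EuclideanSpace.single j 1)
          (EuclideanSpace.single i 1)
        rw [real_inner_comm] at h4
        simp [prodBasis, v, inner_smul_right, inner_smul_left, h4]
      · simp only [Matrix.of_apply, Matrix.fromBlocks_apply₁₂, Matrix.zero_apply]
        rw [hinr]
        exact hν.inner_fderiv _ hz _ _
      · simp
      · simp only [Matrix.of_apply, Matrix.fromBlocks_apply₂₂]
        rw [hinr, Matrix.one_apply]
        exact ho i j
    rw [this, Matrix.det_fromBlocks_zero₁₂, Matrix.det_one, mul_one, Matrix.det_transpose]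
  rw [det_splitEquiv_comp, ← h2, ← h3, abs_mul, mul_comm]

end IsNormalFrame

/-! ### The volume estimate and its strict form. -/

theorem isAddHaarMeasure_volume_prod (n m : ℕ) :
    (volume : Measure (Euc n × Euc (m + 1))).IsAddHaarMeasure :=
  Measure.prod.instIsAddHaarMeasure volume volume

/-- A Haar measure on `ℝ^{n+m+1}`: the pullback of Lebesgue measure on `ℝ^n × ℝ^{m+1}`. -/
noncomputable def splitVolume (n m : ℕ) : Measure (Euc (n + m + 1)) :=
  Measure.map (splitEquiv n m).symm volume

/-- The integral of `(y₀)₊ⁿ` over the unit ball of `ℝ^{m+1}`. -/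
noncomputable def ballConst (n m : ℕ) : ℝ≥0∞ :=
  ∫⁻ y in Metric.ball (0 : Euc (m + 1)) 1, ENNReal.ofReal (y 0) ^ n

/-- The points `p` of the open unit ball for which `⟨p, ·⟩` attains its maximum over `S` at some
point of `A`. -/
def heightMaxSet {N : ℕ} (S A : Set (Euc N)) : Set (Euc N) :=
  {p | ‖p‖ < 1 ∧ ∃ x ∈ A, ∀ y ∈ S, ⟪p, y⟫_ℝ ≤ ⟪p, x⟫_ℝ}

theorem splitVolume_apply {n m : ℕ} (A : Set (Euc (n + m + 1))) :
    splitVolume n m A = volume (splitEquiv n m '' A) := by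
  have h := (splitEquiv n m).symm.toHomeomorph.toMeasurableEquiv.map_apply (μ := volume) A
  rw [ContinuousLinearEquiv.image_eq_preimage_symm]
  exact h

theorem splitVolume_ball_pos (n m : ℕ) : splitVolume n m (Metric.ball 0 1) ≠ 0 := by
  rw [splitVolume_apply]
  exact (((splitEquiv n m).toHomeomorph.isOpenMap _ Metric.isOpen_ball).measure_pos _
    ((Metric.nonempty_ball.2 one_pos).image _)).ne'

theorem splitVolume_ball_lt_top (n m : ℕ) : splitVolume n m (Metric.ball 0 1) < ⊤ := by
  rw [splitVolume_apply]
  exact (measure_mono (image_mono Metric.ball_subset_closedBall)).trans_lt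
    ((isCompact_closedBall (0 : Euc (n + m + 1)) 1).image
      (splitEquiv n m).continuous).measure_lt_top

theorem ballConst_ne_top (n m : ℕ) : ballConst n m ≠ ⊤ := by
  refine ((setLIntegral_mono' (g := fun _ => 1) measurableSet_ball fun y hy => ?_).trans_lt ?_).ne
  · refine pow_le_one₀ (by positivity) ?_
    rw [← ENNReal.ofReal_one]
    refine ENNReal.ofReal_le_ofReal ((le_abs_self _).trans ?_)
    rw [mem_ball_zero_iff] at hy
    exact (PiLp.norm_apply_le y 0).trans hy.le
  · simpa using measure_ball_lt_top

/-- With the maximum always taken over all of `S`, only the location of the maximum point is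
decomposed; this lets the estimate be proved chart by chart. -/
theorem heightMaxSet_iUnion {N : ℕ} (S : Set (Euc N)) (t : ℕ → Set (Euc N)) :
    heightMaxSet S (⋃ i, t i) = ⋃ i, heightMaxSet S (t i) := by
  ext p
  simp only [heightMaxSet, mem_iUnion, mem_ofPred_eq]
  constructor
  · rintro ⟨h, x, ⟨i, hi⟩, hx⟩
    exact ⟨i, h, x, hi, hx⟩
  · rintro ⟨i, h, x, hi, hx⟩
    exact ⟨h, x, ⟨i, hi⟩, hx⟩

theorem ball_subset_heightMaxSet {N : ℕ} {S : Set (Euc N)} (hS : IsCompact S)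
    (hne : S.Nonempty) : Metric.ball 0 1 ⊆ heightMaxSet S S := fun p hp => by
  obtain ⟨x, hx, hmax⟩ := hS.exists_isMaxOn hne
    (f := fun y => ⟪p, y⟫_ℝ) (by fun_prop)
  exact ⟨by simpa using hp, x, hx, fun y hy => hmax hy⟩

namespace IsNormalFrame

variable {n m : ℕ} {V : Set (Euc n)} {φ : Euc n → Euc (n + m + 1)}
  {ν : Fin (m + 1) → Euc n → Euc (n + m + 1)}

theorem continuousOn_heightHess (hν : IsNormalFrame V φ ν) (hV : IsOpen V)
    (hφ : ContDiffOn ℝ ((⊤ : ℕ∞) : WithTop ℕ∞) φ V) :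
    ContinuousOn (fun z : Euc n × Euc (m + 1) => heightHess φ (normalMap ν z) z.1)
      (V ×ˢ univ) := by
  have h2 : ContinuousOn (fun z : Euc n × Euc (m + 1) => fderiv ℝ (fderiv ℝ φ) z.1)
      (V ×ˢ univ) :=
    ((contDiffOn_fderiv hV hφ).continuousOn_fderiv_of_isOpen hV le_rfl).comp
      continuous_fst.continuousOn fun z hz => hz.1
  exact continuousOn_pi.2 fun i => continuousOn_pi.2 fun k =>
    (hν.contDiffOn_normalMap.continuousOn.inner
      ((h2.clm_apply continuousOn_const).clm_apply continuousOn_const)).neg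

/-- The part of the normal bundle over `D` in which the normal exponential map takes values in the
unit ball and minus the Hessian of the height function is positive semidefinite. -/
def posPart (φ : Euc n → Euc (n + m + 1)) (ν : Fin (m + 1) → Euc n → Euc (n + m + 1))
    (D : Set (Euc n)) : Set (Euc n × Euc (m + 1)) :=
  (D ×ˢ Metric.ball 0 1) ∩ {z | (heightHess φ (normalMap ν z) z.1).PosSemidef}

theorem measurableSet_posPart (hν : IsNormalFrame V φ ν) (hV : IsOpen V)
    (hφ : ContDiffOn ℝ ((⊤ : ℕ∞) : WithTop ℕ∞) φ V) {D : Set (Euc n)} (hD : MeasurableSet D)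
    (hDV : D ⊆ V) : MeasurableSet (posPart φ ν D) := by
  obtain ⟨C, hC, he⟩ := continuousOn_iff_isClosed.1 (hν.continuousOn_heightHess hV hφ) _
    (isClosed_posSemidef n)
  have : posPart φ ν D = (D ×ˢ Metric.ball 0 1) ∩ C := by
    ext z
    have hz : z ∈ D ×ˢ Metric.ball (0 : Euc (m + 1)) 1 →
        ((heightHess φ (normalMap ν z) z.1).PosSemidef ↔ z ∈ C) := fun hz => by
      have h : z ∈ V ×ˢ (univ : Set (Euc (m + 1))) := ⟨hDV hz.1, mem_univ _⟩
      have h2 := Set.ext_iff.1 he z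
      simp only [mem_inter_iff, h, and_true] at h2
      exact h2
    exact and_congr_right hz
  rw [this]
  exact (hD.prod measurableSet_ball).inter hC.measurableSet

/-- At a maximum point the first-order condition puts `p` in the image of the fibre, with `‖y‖ =
‖p‖`, and the second-order condition puts the preimage in `posPart`; the volume of an image is at
most the integral of the Jacobian. -/
theorem splitVolume_heightMaxSet_le (hν : IsNormalFrame V φ ν) {S : Set (Euc (n + m + 1))}
    (h : IsLocalParam S V φ) {D : Set (Euc n)} (hD : MeasurableSet D) (hDV : D ⊆ V) :
    splitVolume n m (heightMaxSet S (φ '' D)) ≤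
      ∫⁻ z in D ×ˢ Metric.ball 0 1, (posPart φ ν D).indicator (fun z => ENNReal.ofReal
        |((splitEquiv n m : Euc (n + m + 1) →L[ℝ] Euc n × Euc (m + 1)) ∘L
          fderiv ℝ (normalMap ν) z).det|) z := by
  have hm := hν.measurableSet_posPart h.isOpen_source h.smooth hD hDV
  have hsub : heightMaxSet S (φ '' D) ⊆ normalMap ν '' posPart φ ν D := by
    rintro p ⟨hp, _, ⟨u, hu, rfl⟩, hmax⟩
    have hmaxV : ∀ v ∈ V, ⟪p, φ v⟫_ℝ ≤ ⟪p, φ u⟫_ℝ := fun v hv => hmax _ (h.image_subset ⟨v, hv, rfl⟩)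
    obtain ⟨y, rfl⟩ := hν.exists_normalMap_eq (hDV hu) (h.immersion u (hDV hu))
      (inner_fderiv_eq_zero_of_isMaxOn h.isOpen_source (h.smooth.differentiableOn (by simp))
        (hDV hu) hmaxV)
    rw [hν.norm_normalMap (hDV hu)] at hp
    exact ⟨(u, y), ⟨⟨hu, by simpa using hp⟩,
      heightHess_posSemidef_of_isMaxOn h.isOpen_source h.smooth (hDV hu) hmaxV⟩, rfl⟩
  refine (measure_mono hsub).trans ?_
  rw [splitVolume_apply, ← image_comp, setLIntegral_indicator hm,
    inter_eq_self_of_subset_left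
      (show posPart φ ν D ⊆ D ×ˢ Metric.ball 0 1 from inter_subset_left)]
  have := isAddHaarMeasure_volume_prod n m
  refine addHaar_image_le_lintegral_abs_det_fderiv volume hm fun z hz => ?_
  refine HasFDerivAt.hasFDerivWithinAt ?_
  exact (splitEquiv n m : Euc (n + m + 1) →L[ℝ] Euc n × Euc (m + 1)).hasFDerivAt.comp z
    (hν.hasFDerivAt_normalMap h.isOpen_source (hDV hz.1.1)).differentiableAt.hasFDerivAt

/-- On `posPart`, combine the Jacobian identity with the determinant inequality and cancel one
factor `normDet`. Elsewhere the left side is zero, and strictness only needs `y₀ > 0`. -/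
theorem indicator_posPart_le (hν : IsNormalFrame V φ ν) (hn : 1 ≤ n)
    {S : Set (Euc (n + m + 1))} (h : IsLocalParam S V φ)
    (hH : ∀ u ∈ V, meanCurvature φ u = 0) (D : Set (Euc n)) {z : Euc n × Euc (m + 1)}
    (hz : z.1 ∈ V) :
    (posPart φ ν D).indicator (fun z => ENNReal.ofReal
        |((splitEquiv n m : Euc (n + m + 1) →L[ℝ] Euc n × Euc (m + 1)) ∘L
          fderiv ℝ (normalMap ν) z).det|) z ≤
      ENNReal.ofReal (fderiv ℝ φ z.1).toLinearMap.normDet * ENNReal.ofReal (z.2 0) ^ n ∧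
    (0 < z.2 0 → heightHess φ (normalMap ν z) z.1 ≠ z.2 0 • metricMatrix φ z.1 →
      (posPart φ ν D).indicator (fun z => ENNReal.ofReal
        |((splitEquiv n m : Euc (n + m + 1) →L[ℝ] Euc n × Euc (m + 1)) ∘L
          fderiv ℝ (normalMap ν) z).det|) z <
      ENNReal.ofReal (fderiv ℝ φ z.1).toLinearMap.normDet * ENNReal.ofReal (z.2 0) ^ n) := by
  have hr := normDet_pos (L := (fderiv ℝ φ z.1).toLinearMap) (h.immersion _ hz)
  by_cases hmem : z ∈ posPart φ ν D
  · rw [indicator_of_mem hmem]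
    obtain ⟨h0, h1, h2⟩ := det_le_of_trace_inv_mul_eq hn (metricMatrix_posDef (h.immersion _ hz))
      hmem.2 (hν.trace_inv_mul_heightHess hn h.isOpen_source h.smooth hz (h.immersion _ hz)
        (hH _ hz) z.2)
    have hJ := hν.abs_det_mul_normDet h.isOpen_source h.smooth hz
    rw [abs_of_nonneg (hmem.2 : (heightHess φ (normalMap ν z) z.1).PosSemidef).det_nonneg] at hJ
    rw [← normDet_fderiv_sq, sq, ← mul_assoc] at h1 h2
    rw [← ENNReal.ofReal_pow h0, ← ENNReal.ofReal_mul hr.le]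
    constructor
    · refine ENNReal.ofReal_le_ofReal ?_
      rw [mul_comm (LinearMap.normDet _)]
      exact le_of_mul_le_mul_right (hJ.trans_le h1) hr
    · intro hpos hne
      refine (ENNReal.ofReal_lt_ofReal_iff (by positivity)).2 ?_
      rw [mul_comm (LinearMap.normDet _)]
      exact lt_of_mul_lt_mul_right (hJ.trans_lt (h2 hpos hne)) hr.le
  · rw [indicator_of_notMem hmem]
    refine ⟨zero_le, fun hpos _ => ENNReal.mul_pos ?_ ?_⟩
    · simpa using hr
    · simpa using fun h => absurd h hpos.not_ge

theorem lintegral_eq_ballConst_mul {S : Set (Euc (n + m + 1))} (h : IsLocalParam S V φ)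
    {D : Set (Euc n)} (hD : MeasurableSet D) (hDV : D ⊆ V) :
    AEMeasurable (fun z : Euc n × Euc (m + 1) =>
      ENNReal.ofReal (fderiv ℝ φ z.1).toLinearMap.normDet * ENNReal.ofReal (z.2 0) ^ n)
      (volume.restrict (D ×ˢ Metric.ball 0 1)) ∧
    ∫⁻ z in D ×ˢ Metric.ball (0 : Euc (m + 1)) 1,
      ENNReal.ofReal (fderiv ℝ φ z.1).toLinearMap.normDet * ENNReal.ofReal (z.2 0) ^ n =
    ballConst n m * vol n (φ '' D) := by
  have h1 : AEMeasurable (fun u => ENNReal.ofReal (fderiv ℝ φ u).toLinearMap.normDet)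
      (volume.restrict D) :=
    ((continuousOn_normDet_fderiv (h.smooth.continuousOn_fderiv_of_isOpen h.isOpen_source
      (by simp))).mono hDV).aemeasurable hD |>.ennreal_ofReal
  have h2 : AEMeasurable (fun y : Euc (m + 1) => ENNReal.ofReal (y 0) ^ n)
      (volume.restrict (Metric.ball 0 1)) := by
    refine Measurable.aemeasurable ?_
    fun_prop
  have hp : (volume : Measure (Euc n × Euc (m + 1))).restrict (D ×ˢ Metric.ball 0 1) =
      (volume.restrict D).prod (volume.restrict (Metric.ball 0 1)) := by
    rw [Measure.volume_eq_prod, Measure.prod_restrict]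
  rw [hp, vol_image_eq_lintegral h.isOpen_source (h.smooth.of_le (by simp)) h.injOn h.immersion
    hD hDV, lintegral_prod_mul h1 h2, mul_comm]
  exact ⟨(h1.comp_fst).mul h2.comp_snd, rfl⟩

theorem splitVolume_heightMaxSet_le_vol (hν : IsNormalFrame V φ ν) (hn : 1 ≤ n)
    {S : Set (Euc (n + m + 1))} (h : IsLocalParam S V φ)
    (hH : ∀ u ∈ V, meanCurvature φ u = 0) {D : Set (Euc n)} (hD : MeasurableSet D)
    (hDV : D ⊆ V) :
    splitVolume n m (heightMaxSet S (φ '' D)) ≤ ballConst n m * vol n (φ '' D) := by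
  rw [← (lintegral_eq_ballConst_mul h hD hDV).2]
  refine (hν.splitVolume_heightMaxSet_le h hD hDV).trans
    (setLIntegral_mono' (hD.prod measurableSet_ball) fun z hz => ?_)
  exact (hν.indicator_posPart_le hn h hH D (hDV hz.1)).1

/-- Take `p = φ / 2 + t w` with `w` the nonzero value of `II`. Then `B - y₀ g = -t ⟨w, II⟩`, and its
vanishing on coordinate vectors would give `⟨w, w⟩ = 0`. -/
theorem exists_heightHess_ne (hν : IsNormalFrame V φ ν) {S : Set (Euc (n + m + 1))}
    (h : IsLocalParam S V φ) {u : Euc n} (hu : u ∈ V) {a b : Euc n}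
    (hII : secondFundForm φ u a b ≠ 0) :
    ∃ y : Euc (m + 1), ‖y‖ < 1 ∧ 0 < y 0 ∧
      heightHess φ (normalMap ν (u, y)) u ≠ y 0 • metricMatrix φ u := by
  set w := secondFundForm φ u a b with hw
  have hwN : w ∈ normalSpaceAt φ u := Submodule.starProjection_apply_mem _ _
  rw [normalSpaceAt, ← Submodule.inf_orthogonal, Submodule.mem_inf,
    Submodule.mem_orthogonal_singleton_iff_inner_right] at hwN
  obtain ⟨c, hc⟩ := hν.exists_normalMap_eq hu (h.immersion u hu) (p := w) fun a => by
    rw [real_inner_comm]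
    exact (Submodule.mem_orthogonal _ _).1 hwN.1 _ ⟨a, rfl⟩
  have hc0 : c 0 = 0 := by
    have := hν.inner_normalMap (z := (u, c)) hu 0
    rw [hc, hν.zero u hu] at this
    rw [← this]
    exact hwN.2
  -- This choice makes `t ‖c‖ < 1/4`, so that `‖y‖ < 3/4`.
  have ht : 0 < (4 * (‖c‖ + 1))⁻¹ := by positivity
  set t := (4 * (‖c‖ + 1))⁻¹ with ht'
  have hts : t * (4 * (‖c‖ + 1)) = 1 := inv_mul_cancel₀ (by positivity)
  set y : Euc (m + 1) := t • c + (1 / 2 : ℝ) • EuclideanSpace.single 0 1 with hy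
  have hy0 : y 0 = 1 / 2 := by simp [hy, hc0]
  refine ⟨y, ?_, by rw [hy0]; norm_num, fun heq => ?_⟩
  · refine (norm_add_le _ _).trans_lt ?_
    rw [norm_smul, norm_smul, PiLp.norm_single, Real.norm_of_nonneg ht.le]
    norm_num
    nlinarith [norm_nonneg c]
  · have hq : normalMap ν (u, y) - y 0 • φ u = t • w := by
      rw [← hc, hy0, ← hν.zero u hu]
      simp only [normalMap, hy, PiLp.add_apply, PiLp.smul_apply, smul_eq_mul, add_smul,
        Finset.sum_add_distrib, mul_smul, Finset.smul_sum]
      simp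
    have hik : ∀ i k, ⟪w, secondFundForm φ u (EuclideanSpace.single i 1)
        (EuclideanSpace.single k 1)⟫_ℝ = 0 := fun i k => by
      have h1 := hν.heightHess_normalMap h.isOpen_source h.smooth hu y i k
      rw [heq, hq, inner_smul_left] at h1
      simp only [Matrix.smul_apply, smul_eq_mul, conj_trivial] at h1
      have h2 : t * ⟪w, secondFundForm φ u (EuclideanSpace.single i 1)
        (EuclideanSpace.single k 1)⟫_ℝ = 0 := by linarith
      exact (mul_eq_zero.1 h2).resolve_left ht.ne'
    have hww : ⟪w, w⟫_ℝ = 0 := by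
      conv_lhs =>
        arg 3
        rw [hw, secondFundForm, ← sum_smul_single a, ← sum_smul_single b]
      simp only [map_sum, map_smul, sum_apply, smul_apply, inner_sum, inner_smul_right]
      refine Finset.sum_eq_zero fun i _ => ?_
      rw [mul_eq_zero]
      right
      refine Finset.sum_eq_zero fun k _ => ?_
      rw [mul_eq_zero]
      right
      exact hik _ _
    exact hII (inner_self_eq_zero.1 hww)

theorem splitVolume_heightMaxSet_lt_vol (hν : IsNormalFrame V φ ν) (hn : 1 ≤ n)
    {S : Set (Euc (n + m + 1))} (h : IsLocalParam S V φ)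
    (hH : ∀ u ∈ V, meanCurvature φ u = 0) (hfin : vol n (φ '' V) ≠ ⊤) {u : Euc n} (hu : u ∈ V)
    {a b : Euc n} (hII : secondFundForm φ u a b ≠ 0) :
    splitVolume n m (heightMaxSet S (φ '' V)) < ballConst n m * vol n (φ '' V) := by
  have hVo := h.isOpen_source
  obtain ⟨y, hy1, hy0, hyne⟩ := hν.exists_heightHess_ne h hu hII
  obtain ⟨hae, hint⟩ := lintegral_eq_ballConst_mul (m := m) h hVo.measurableSet Subset.rfl
  have hle := hν.splitVolume_heightMaxSet_le h hVo.measurableSet Subset.rfl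
  have hpt := fun z (hz : z ∈ V ×ˢ Metric.ball (0 : Euc (m + 1)) 1) =>
    hν.indicator_posPart_le hn h hH V hz.1
  refine hle.trans_lt ?_
  rw [← hint]
  have hms : MeasurableSet (V ×ˢ Metric.ball (0 : Euc (m + 1)) 1) :=
    hVo.measurableSet.prod measurableSet_ball
  -- The strict pointwise inequality holds on this open set, which is nonempty and so has positive
  -- measure.
  let O : Set (Euc n × Euc (m + 1)) := (V ×ˢ Metric.ball 0 1) ∩ ((fun z => (z.2 0,
    heightHess φ (normalMap ν z) z.1 - z.2 0 • metricMatrix φ z.1)) ⁻¹' (Ioi 0 ×ˢ {0}ᶜ))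
  have hO : IsOpen O := by
    refine ContinuousOn.isOpen_inter_preimage ?_ (hVo.prod Metric.isOpen_ball)
      (isOpen_Ioi.prod isOpen_compl_singleton)
    have h0 : ContinuousOn (fun z : Euc n × Euc (m + 1) => z.2 0)
      (V ×ˢ Metric.ball 0 1) := by fun_prop
    refine h0.prodMk (ContinuousOn.sub ?_ (h0.smul ?_))
    · exact (hν.continuousOn_heightHess hVo h.smooth).mono (prod_mono_right (subset_univ _))
    · exact (continuousOn_metricMatrix (h.smooth.continuousOn_fderiv_of_isOpen hVo
        (by simp))).comp continuous_fst.continuousOn fun z hz => hz.1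
  refine lintegral_strict_mono_of_ae_le_of_ae_lt_on (s := O) hae ?_ ?_ ?_ ?_
  · refine ((setLIntegral_mono' hms fun z hz => (hpt z hz).1).trans_lt ?_).ne
    rw [hint]
    exact ENNReal.mul_lt_top (ballConst_ne_top n m).lt_top hfin.lt_top
  · exact (ae_restrict_iff' hms).2 (Eventually.of_forall fun z hz => (hpt z hz).1)
  · rw [Measure.restrict_apply hO.measurableSet, inter_eq_self_of_subset_left inter_subset_left]
    exact (hO.measure_pos volume ⟨(u, y), ⟨hu, by simpa using hy1⟩, hy0, sub_ne_zero.2 hyne⟩).ne'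
  · exact (ae_restrict_iff' hms).2 (Eventually.of_forall fun z hz hzO =>
      (hpt z hz).2 hzO.2.1 (sub_ne_zero.1 hzO.2.2))

end IsNormalFrame

theorem IsLocalParam.eq_image_of_subset {n N : ℕ} {S : Set (Euc N)} {V : Set (Euc n)}
    {φ : Euc n → Euc N} (h : IsLocalParam S V φ) {D : Set (Euc N)} (hD : MeasurableSet D)
    (hDs : D ⊆ φ '' V) : ∃ D' ⊆ V, MeasurableSet D' ∧ D = φ '' D' := by
  refine ⟨V ∩ φ ⁻¹' D, inter_subset_left, ?_, ?_⟩
  · have h1 : Measurable (V.domRestrict φ) := h.embedding.continuous.measurable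
    have h2 := (MeasurableEmbedding.subtype_coe h.isOpen_source.measurableSet).measurableSet_image.2
      (h1 hD)
    convert h2 using 1
    ext u
    simp [Set.domRestrict, and_comm]
  · ext x
    constructor
    · intro hx
      obtain ⟨u, hu, rfl⟩ := hDs hx
      exact ⟨u, ⟨hu, hx⟩, rfl⟩
    · rintro ⟨u, hu, rfl⟩
      exact hu.2

theorem splitVolume_heightMaxSet_le_ballConst_mul_vol {n m : ℕ} (hn : 1 ≤ n)
    {S : Set (Euc (n + m + 1))} (hS : IsClosedSubmanifoldOfSphere n (n + m) S)
    (hmin : IsMinimal n S) {A : Set (Euc (n + m + 1))} (hA : MeasurableSet A) (hAS : A ⊆ S) :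
    splitVolume n m (heightMaxSet S A) ≤ ballConst n m * vol n A := by
  refine le_of_forall_exists_open_le (fun A => splitVolume n m (heightMaxSet S A))
    (fun A => ballConst n m * vol n A) hA ?_ (fun t => ?_) (fun t ht hd _ => ?_) fun x hx => ?_
  · simp [heightMaxSet]
  · simp only [heightMaxSet_iUnion]
    exact measure_iUnion_le _
  · rw [ENNReal.tsum_mul_left]
    exact le_of_eq (congrArg _ (measure_iUnion hd ht).symm)
  · obtain ⟨V, φ, ν, h, hν, hxV⟩ :=
      exists_isLocalParam_isNormalFrame hS.isSubmanifold hS.subset_sphere (hAS hx)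
    obtain ⟨U, hU, hUe⟩ := h.isOpen_image
    refine ⟨U, hU, by rw [hUe] at hxV; exact hxV.2, fun D hD hDm => ?_⟩
    obtain ⟨D', hD'V, hD'm, rfl⟩ := h.eq_image_of_subset hDm
      (by rw [hUe]; exact hD.trans (inter_subset_inter_left _ hAS))
    exact hν.splitVolume_heightMaxSet_le_vol hn h (hmin V φ h) hD'm hD'V

theorem splitVolume_ball_le {n m : ℕ} (hn : 1 ≤ n) {S : Set (Euc (n + m + 1))}
    (hS : IsClosedSubmanifoldOfSphere n (n + m) S) (hmin : IsMinimal n S) :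
    splitVolume n m (Metric.ball 0 1) ≤ ballConst n m * vol n S :=
  (measure_mono (ball_subset_heightMaxSet hS.isCompact hS.nonempty)).trans
    (splitVolume_heightMaxSet_le_ballConst_mul_vol hn hS hmin hS.isCompact.measurableSet Subset.rfl)

/-- Read off from the volume estimate: otherwise the unit ball would be null. -/
theorem ballConst_ne_zero {n m : ℕ} (hn : 1 ≤ n) {S : Set (Euc (n + m + 1))}
    (hS : IsClosedSubmanifoldOfSphere n (n + m) S) (hmin : IsMinimal n S) :
    ballConst n m ≠ 0 := fun h => by
  have := splitVolume_ball_le hn hS hmin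
  rw [h, zero_mul] at this
  exact splitVolume_ball_pos n m (le_antisymm this zero_le)

/-- Where `II ≠ 0`, the estimate is strict on a chart image around the point; adding the weak
estimate on the rest of `S` contradicts the assumed inequality. -/
theorem isTotallyGeodesic_of_le {n m : ℕ} (hn : 1 ≤ n) {S : Set (Euc (n + m + 1))}
    (hS : IsClosedSubmanifoldOfSphere n (n + m) S) (hmin : IsMinimal n S) (hfin : vol n S ≠ ⊤)
    (hle : ballConst n m * vol n S ≤ splitVolume n m (Metric.ball 0 1)) :
    IsTotallyGeodesic n S := by
  intro V φ h u hu a b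
  by_contra hII
  obtain ⟨V', hsub, hV', hu', ν, hν⟩ := exists_isNormalFrame (m := m) h.isOpen_source h.smooth
    h.immersion (fun v hv => by
      simpa [unitSphere] using hS.subset_sphere (h.image_subset ⟨v, hv, rfl⟩)) hu
  have h' := h.mono hV' hsub
  have hAm : MeasurableSet (φ '' V') := by
    obtain ⟨U, hU, hUe⟩ := h'.isOpen_image
    rw [hUe]
    exact hS.isCompact.measurableSet.inter hU.measurableSet
  have hlt := hν.splitVolume_heightMaxSet_lt_vol hn h' (hmin V' φ h')
    (ne_top_of_le_ne_top hfin (measure_mono h'.image_subset)) hu' hII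
  have hle2 := splitVolume_heightMaxSet_le_ballConst_mul_vol hn hS hmin
    (hS.isCompact.measurableSet.diff hAm) sdiff_subset
  have hfin2 : splitVolume n m (heightMaxSet S (S \ φ '' V')) ≠ ⊤ :=
    (hle2.trans_lt (ENNReal.mul_lt_top (ballConst_ne_top n m).lt_top
      ((measure_mono sdiff_subset).trans_lt hfin.lt_top))).ne
  have hball : Metric.ball 0 1 ⊆ heightMaxSet S (φ '' V') ∪ heightMaxSet S (S \ φ '' V') :=
    (ball_subset_heightMaxSet hS.isCompact hS.nonempty).trans fun p ⟨hp, x, hx, hmax⟩ => by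
      by_cases hxA : x ∈ φ '' V'
      · exact Or.inl ⟨hp, x, hxA, hmax⟩
      · exact Or.inr ⟨hp, x, ⟨hx, hxA⟩, hmax⟩
  have hsum : vol n S = vol n (φ '' V') + vol n (S \ φ '' V') := by
    have := measure_inter_add_sdiff (μ := Measure.euclideanHausdorffMeasure n) S hAm
    rw [inter_eq_self_of_subset_right h'.image_subset] at this
    exact this.symm
  refine lt_irrefl (splitVolume n m (Metric.ball 0 1)) ?_
  calc splitVolume n m (Metric.ball 0 1)
      ≤ splitVolume n m (heightMaxSet S (φ '' V')) +
          splitVolume n m (heightMaxSet S (S \ φ '' V')) :=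
        (measure_mono hball).trans (measure_union_le _ _)
    _ < ballConst n m * vol n (φ '' V') + ballConst n m * vol n (S \ φ '' V') :=
        ENNReal.add_lt_add_of_lt_of_le hfin2 hlt hle2
    _ = ballConst n m * vol n S := by rw [hsum, mul_add]
    _ ≤ _ := hle

/-! ### Geometry of great spheres. -/

theorem isEmbedding_of_continuousAt_leftInverse {X Y : Type*} [TopologicalSpace X]
    [TopologicalSpace Y] {f : X → Y} {g : Y → X} (hf : Continuous f)
    (hg : ∀ x, ContinuousAt g (f x)) (hgf : Function.LeftInverse g f) :
    Topology.IsEmbedding f := by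
  refine ⟨Topology.isInducing_iff_nhds.2 fun x => le_antisymm (tendsto_iff_comap.1 hf.continuousAt) ?_,
    hgf.injective⟩
  have h : Tendsto (g ∘ f) (comap f (𝓝 (f x))) (𝓝 x) := by
    have := (hg x).tendsto.comp (tendsto_comap (f := f))
    rwa [hgf x] at this
  rwa [hgf.comp_eq_id, tendsto_id'] at h

theorem exists_linearIsometry_range {n N : ℕ} {U : Submodule ℝ (Euc N)}
    (hU : Module.finrank ℝ U = n) :
    ∃ L : Euc n →ₗᵢ[ℝ] Euc N, LinearMap.range L.toLinearMap = U := by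
  let e := ((stdOrthonormalBasis ℝ U).reindex (finCongr hU)).repr
  refine ⟨U.subtypeₗᵢ.comp e.symm.toLinearIsometry, ?_⟩
  ext x
  constructor
  · rintro ⟨v, rfl⟩
    exact (e.symm v).2
  · intro hx
    exact ⟨e ⟨x, hx⟩, by simp⟩

/-- The chart `φ` is the central projection to the sphere of the affine plane `x₀ + (x₀^⊥ ∩ W)`; its
image is the open hemisphere around `x₀`. The left inverse `ψ` divides by `⟨x₀, x⟩`, hence is only
differentiable at points of the image, and its derivative also shows that `φ` is an immersion. -/
theorem exists_isLocalParam_greatSphere {n k : ℕ} {W : Submodule ℝ (Euc (k + 1))}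
    (hW : Module.finrank ℝ W = n + 1) {x₀ : Euc (k + 1)} (hx₀ : x₀ ∈ (W : Set _) ∩ unitSphere k) :
    ∃ (V : Set (Euc n)) (φ : Euc n → Euc (k + 1)),
      IsLocalParam ((W : Set _) ∩ unitSphere k) V φ ∧ x₀ ∈ φ '' V := by
  have hx1 : ‖x₀‖ = 1 := by simpa [unitSphere] using hx₀.2
  have hsub : Submodule.span ℝ {x₀} ≤ W := by
    rw [Submodule.span_singleton_le_iff_mem]
    exact hx₀.1
  have hfr : Module.finrank ℝ ((Submodule.span ℝ {x₀})ᗮ ⊓ W : Submodule ℝ (Euc (k + 1))) = n := by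
    have h := Submodule.finrank_add_inf_finrank_orthogonal hsub
    rw [finrank_span_singleton (by rintro rfl; simp at hx1), hW] at h
    omega
  obtain ⟨L, hL⟩ := exists_linearIsometry_range hfr
  have hLmem : ∀ v, L v ∈ W ∧ ⟪x₀, L v⟫_ℝ = 0 := fun v => by
    have : L v ∈ LinearMap.range L.toLinearMap := ⟨v, rfl⟩
    rw [hL, Submodule.mem_inf, Submodule.mem_orthogonal_singleton_iff_inner_right] at this
    exact ⟨this.2, this.1⟩
  have hxx : ⟪x₀, x₀⟫_ℝ = 1 := by rw [real_inner_self_eq_norm_sq, hx1, one_pow]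
  have hinner : ∀ v, ⟪x₀, x₀ + L v⟫_ℝ = 1 := fun v => by
    rw [inner_add_right, hxx, (hLmem v).2, add_zero]
  have hne : ∀ v, x₀ + L v ≠ 0 := fun v h => by
    have := hinner v
    rw [h, inner_zero_right] at this
    exact zero_ne_one this
  let φ : Euc n → Euc (k + 1) := fun v => ‖x₀ + L v‖⁻¹ • (x₀ + L v)
  let ψ : Euc (k + 1) → Euc n := fun x =>
    (⟪x₀, x⟫_ℝ)⁻¹ • ContinuousLinearMap.adjoint L.toContinuousLinearMap x
  have hpos : ∀ v, 0 < ⟪x₀, φ v⟫_ℝ := fun v => by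
    simp only [φ, inner_smul_right, hinner, mul_one]
    exact inv_pos.2 (norm_pos_iff.2 (hne v))
  have hadj : ∀ v, ContinuousLinearMap.adjoint L.toContinuousLinearMap (x₀ + L v) = v := fun v => by
    refine ext_inner_right ℝ fun w => ?_
    rw [ContinuousLinearMap.adjoint_inner_left, inner_add_left]
    change ⟪x₀, L w⟫_ℝ + ⟪L v, L w⟫_ℝ = _
    rw [(hLmem w).2, zero_add, L.inner_map_map]
  have hψφ : Function.LeftInverse ψ φ := fun v => by
    simp only [ψ, φ, inner_smul_right, hinner, map_smul, hadj, mul_one, inv_inv, smul_smul]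
    rw [mul_inv_cancel₀ (norm_ne_zero_iff.2 (hne v)), one_smul]
  have hφs : ContDiff ℝ ((⊤ : ℕ∞) : WithTop ℕ∞) φ := by
    have h1 : ContDiff ℝ ((⊤ : ℕ∞) : WithTop ℕ∞) fun v => x₀ + L v :=
      contDiff_const.add L.contDiff
    exact ((h1.norm ℝ hne).inv fun v => norm_ne_zero_iff.2 (hne v)).smul h1
  have hψd : ∀ v, DifferentiableAt ℝ ψ (φ v) := fun v => by
    refine DifferentiableAt.smul (DifferentiableAt.inv ?_ (hpos v).ne') ?_
    · exact (differentiableAt_const x₀).inner ℝ differentiableAt_id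
    · exact ContinuousLinearMap.differentiableAt _
  have himage : φ '' univ = ((W : Set _) ∩ unitSphere k) ∩ {x | 0 < ⟪x₀, x⟫_ℝ} := by
    ext x
    constructor
    · rintro ⟨v, -, rfl⟩
      refine ⟨⟨W.smul_mem _ (W.add_mem hx₀.1 (hLmem v).1), ?_⟩, hpos v⟩
      simp only [unitSphere, mem_sphere_zero_iff_norm, φ]
      exact norm_smul_inv_norm (𝕜 := ℝ) (hne v)
    · rintro ⟨⟨hxW, hxs⟩, hxp⟩
      have hxp' : 0 < ⟪x₀, x⟫_ℝ := hxp
      have hxs' : ‖x‖ = 1 := by simpa [unitSphere] using hxs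
      set c := ⟪x₀, x⟫_ℝ with hc
      have hmem : c⁻¹ • x - x₀ ∈ LinearMap.range L.toLinearMap := by
        rw [hL, Submodule.mem_inf, Submodule.mem_orthogonal_singleton_iff_inner_right]
        refine ⟨?_, W.sub_mem (W.smul_mem _ hxW) hx₀.1⟩
        rw [inner_sub_right, inner_smul_right, ← hc, inv_mul_cancel₀ hxp'.ne', hxx, sub_self]
      obtain ⟨v, hv⟩ := hmem
      have hv' : x₀ + L v = c⁻¹ • x := by
        have : L v = c⁻¹ • x - x₀ := hv
        rw [this]
        abel
      refine ⟨v, mem_univ v, ?_⟩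
      simp only [φ, hv', norm_smul, hxs', mul_one, norm_inv, inv_inv, smul_smul]
      rw [Real.norm_of_nonneg hxp'.le, mul_inv_cancel₀ hxp'.ne', one_smul]
  refine ⟨univ, φ, ⟨isOpen_univ, hφs.contDiffOn, fun v _ => ?_, ?_, ?_⟩, ?_⟩
  · have hd := (hψd v).hasFDerivAt.comp v
      ((hφs.differentiable (by simp)) v).hasFDerivAt
    rw [hψφ.comp_eq_id] at hd
    have h := hd.unique (hasFDerivAt_id v)
    refine Function.LeftInverse.injective (g := fderiv ℝ ψ (φ v)) fun a => ?_
    exact congrArg (fun T => T a) h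
  · refine Topology.IsEmbedding.comp (g := φ) ?_ Topology.IsEmbedding.subtypeVal
    exact isEmbedding_of_continuousAt_leftInverse hφs.continuous
      (fun v => (hψd v).continuousAt) hψφ
  · exact ⟨_, isOpen_lt continuous_const (by fun_prop), himage⟩
  · rw [himage]
    exact ⟨hx₀, by rw [mem_ofPred_eq, hxx]; exact one_pos⟩

theorem isClosedSubmanifoldOfSphere_greatSphere {n k : ℕ} {W : Submodule ℝ (Euc (k + 1))}
    (hW : Module.finrank ℝ W = n + 1) :
    IsClosedSubmanifoldOfSphere n k ((W : Set _) ∩ unitSphere k) where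
  nonempty := by
    have : Nontrivial W := Module.nontrivial_of_finrank_pos (R := ℝ) (by omega)
    obtain ⟨w, hw⟩ := exists_norm_eq W (c := 1) zero_le_one
    exact ⟨w, w.2, by simpa [unitSphere] using hw⟩
  isCompact := (isCompact_sphere _ _).inter_left (Submodule.closed_of_finiteDimensional W)
  subset_sphere := inter_subset_right
  isSubmanifold _ hx := exists_isLocalParam_greatSphere hW hx

theorem finrank_tangentSpaceAt_sup {n N : ℕ} {φ : Euc n → Euc N} {V : Set (Euc n)}
    (hV : IsOpen V) (hφ : DifferentiableOn ℝ φ V) (h1 : ∀ u ∈ V, ‖φ u‖ = 1) {u : Euc n}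
    (hu : u ∈ V) (hinj : Function.Injective (fderiv ℝ φ u)) :
    Module.finrank ℝ (tangentSpaceAt φ u ⊔ Submodule.span ℝ {φ u} : Submodule ℝ (Euc N)) =
      n + 1 := by
  have hdisj : tangentSpaceAt φ u ⊓ Submodule.span ℝ {φ u} = ⊥ := by
    rw [← disjoint_iff]
    refine (Submodule.orthogonal_disjoint _).mono_right ?_
    rw [Submodule.span_singleton_le_iff_mem, Submodule.mem_orthogonal]
    rintro _ ⟨a, rfl⟩
    exact inner_fderiv_eq_zero_of_norm_eq_one hV hφ h1 hu a
  have h := Submodule.finrank_sup_add_finrank_inf_eq (tangentSpaceAt φ u)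
    (Submodule.span ℝ {φ u})
  have hT : Module.finrank ℝ (tangentSpaceAt φ u) = n := finrank_range_fderiv hinj
  rw [hdisj, finrank_bot, add_zero, hT, finrank_span_singleton] at h
  · exact h
  · intro h0
    have := h1 u hu
    rw [h0, norm_zero] at this
    exact zero_ne_one this

theorem fderiv_mem_of_forall_mem {E F : Type*} [NormedAddCommGroup E] [NormedSpace ℝ E]
    [NormedAddCommGroup F] [InnerProductSpace ℝ F] {W : Submodule ℝ F}
    [FiniteDimensional ℝ F] {f : E → F} {V : Set E} (hV : IsOpen V) (hf : ∀ v ∈ V, f v ∈ W)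
    {u : E} (hu : u ∈ V) (hd : DifferentiableAt ℝ f u) (a : E) : fderiv ℝ f u a ∈ W := by
  have he : Wᗮ.starProjection ∘ f =ᶠ[𝓝 u] fun _ => 0 := by
    filter_upwards [hV.mem_nhds hu] with v hv
    exact (Submodule.starProjection_apply_eq_zero_iff _).2 (by
      rw [Submodule.orthogonal_orthogonal]
      exact hf v hv)
  have h1 := (Wᗮ.starProjection.hasFDerivAt.comp u hd.hasFDerivAt).fderiv
  rw [he.fderiv_eq, fderiv_fun_const] at h1
  have h2 := congrArg (fun L => L a) h1
  have h3 : Wᗮ.starProjection (fderiv ℝ f u a) = 0 := h2.symm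
  have h4 := (Submodule.starProjection_apply_eq_zero_iff _).1 h3
  rwa [Submodule.orthogonal_orthogonal] at h4

/-- The linear subspace containing a chart is determined by first-order data at a single point; this
later identifies the subspaces of overlapping charts. -/
theorem tangentSpaceAt_sup_eq_of_forall_mem {n N : ℕ} {φ : Euc n → Euc N} {V : Set (Euc n)}
    (hV : IsOpen V) (hφ : DifferentiableOn ℝ φ V) (h1 : ∀ u ∈ V, ‖φ u‖ = 1)
    {W : Submodule ℝ (Euc N)} (hW : Module.finrank ℝ W = n + 1) (hmem : ∀ v ∈ V, φ v ∈ W)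
    {u : Euc n} (hu : u ∈ V) (hinj : Function.Injective (fderiv ℝ φ u)) :
    tangentSpaceAt φ u ⊔ Submodule.span ℝ {φ u} = W := by
  refine Submodule.eq_of_le_of_finrank_eq (sup_le ?_ ?_)
    (by rw [finrank_tangentSpaceAt_sup hV hφ h1 hu hinj, hW])
  · rintro _ ⟨a, rfl⟩
    exact fderiv_mem_of_forall_mem hV hmem hu ((hφ u hu).differentiableAt (hV.mem_nhds hu)) a
  · rw [Submodule.span_singleton_le_iff_mem]
    exact hmem u hu

theorem normalSpaceAt_eq_of_forall_mem {n N : ℕ} {φ : Euc n → Euc N} {V : Set (Euc n)}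
    (hV : IsOpen V) (hφ : DifferentiableOn ℝ φ V) (h1 : ∀ u ∈ V, ‖φ u‖ = 1)
    {W : Submodule ℝ (Euc N)} (hW : Module.finrank ℝ W = n + 1) (hmem : ∀ v ∈ V, φ v ∈ W)
    {u : Euc n} (hu : u ∈ V) (hinj : Function.Injective (fderiv ℝ φ u)) :
    normalSpaceAt φ u = Wᗮ := by
  rw [normalSpaceAt, tangentSpaceAt_sup_eq_of_forall_mem hV hφ h1 hW hmem hu hinj]

theorem IsLocalParam.norm_eq_one {n k : ℕ} {S : Set (Euc (k + 1))} {V : Set (Euc n)}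
    {φ : Euc n → Euc (k + 1)} (h : IsLocalParam S V φ) (hS : S ⊆ unitSphere k) :
    ∀ u ∈ V, ‖φ u‖ = 1 := fun u hu => by
  simpa [unitSphere] using hS (h.image_subset ⟨u, hu, rfl⟩)

/-- Since `φ` takes values in `W`, so does its second derivative, whereas the normal space is `Wᗮ`.
-/
theorem isTotallyGeodesic_greatSphere {n k : ℕ} {W : Submodule ℝ (Euc (k + 1))}
    (hW : Module.finrank ℝ W = n + 1) :
    IsTotallyGeodesic n ((W : Set _) ∩ unitSphere k) := by
  intro V φ h u hu a b
  have hVo := h.isOpen_source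
  have hd : DifferentiableOn ℝ φ V := h.smooth.differentiableOn (by simp)
  have hmem : ∀ v ∈ V, φ v ∈ W := fun v hv => (h.image_subset ⟨v, hv, rfl⟩).1
  rw [secondFundForm, Submodule.starProjection_apply_eq_zero_iff,
    normalSpaceAt_eq_of_forall_mem hVo hd (h.norm_eq_one inter_subset_right) hW
    hmem hu (h.immersion u hu), Submodule.orthogonal_orthogonal]
  have hdd := differentiableAt_fderiv hVo h.smooth hu
  have h2 : fderiv ℝ (fun v => fderiv ℝ φ v b) u a = fderiv ℝ (fderiv ℝ φ) u a b := by
    rw [fderiv_clm_apply hdd (differentiableAt_const b)]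
    simp
  rw [← h2]
  exact fderiv_mem_of_forall_mem hVo (fun v hv => fderiv_mem_of_forall_mem hVo hmem hv
    ((hd v hv).differentiableAt (hVo.mem_nhds hv)) b) hu
    (hdd.clm_apply (differentiableAt_const b)) a

theorem exists_isometry_image_unitSphere {n k : ℕ} {W : Submodule ℝ (Euc (k + 1))}
    (hW : Module.finrank ℝ W = n + 1) :
    ∃ L : Euc (n + 1) →ₗᵢ[ℝ] Euc (k + 1), L '' unitSphere n = (W : Set _) ∩ unitSphere k := by
  obtain ⟨L, hL⟩ := exists_linearIsometry_range hW
  refine ⟨L, ?_⟩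
  ext x
  constructor
  · rintro ⟨v, hv, rfl⟩
    refine ⟨?_, by simpa [unitSphere] using hv⟩
    rw [← hL]
    exact ⟨v, rfl⟩
  · rintro ⟨hx, hs⟩
    rw [← hL] at hx
    obtain ⟨v, rfl⟩ := hx
    exact ⟨v, by simpa [unitSphere] using hs, rfl⟩

theorem vol_greatSphere {n k : ℕ} {W : Submodule ℝ (Euc (k + 1))}
    (hW : Module.finrank ℝ W = n + 1) :
    vol n ((W : Set _) ∩ unitSphere k) = vol n (unitSphere n) := by
  obtain ⟨L, hL⟩ := exists_isometry_image_unitSphere hW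
  rw [← hL]
  exact L.isometry.euclideanHausdorffMeasure_image _

theorem nonempty_homeomorph_greatSphere {n k : ℕ} {W : Submodule ℝ (Euc (k + 1))}
    (hW : Module.finrank ℝ W = n + 1) :
    Nonempty (((W : Set _) ∩ unitSphere k : Set _) ≃ₜ unitSphere n) := by
  obtain ⟨L, hL⟩ := exists_isometry_image_unitSphere hW
  rw [← hL]
  exact ⟨(L.isometry.isEmbedding.homeomorphImage _).symm⟩

/-! ### The reverse volume inequality for great spheres. -/

/-- The part of the unit ball over a subset `A` of a great sphere. -/
def coneSet {N : ℕ} (W : Submodule ℝ (Euc N)) (A : Set (Euc N)) : Set (Euc N) :=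
  Metric.ball 0 1 ∩ ({p | W.starProjection p ≠ 0} ∩
    (fun p => ‖W.starProjection p‖⁻¹ • W.starProjection p) ⁻¹' A)

theorem measurableSet_coneSet {N : ℕ} (W : Submodule ℝ (Euc N)) {A : Set (Euc N)}
    (hA : MeasurableSet A) : MeasurableSet (coneSet W A) := by
  have hm : Measurable fun p : Euc N => W.starProjection p := W.starProjection.continuous.measurable
  refine measurableSet_ball.inter (MeasurableSet.inter ?_ ?_)
  · exact (hm (measurableSet_singleton 0)).compl
  · exact (hm.norm.inv.smul hm) hA

/-- Here `B = y₀ g`, so the Jacobian is exactly `y₀ⁿ normDet` where `y₀ > 0`. On that set the normal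
map is injective: the projection of its value to `W` is `y₀ φ u`, whose direction recovers `u`, and
the frame then recovers `y`. -/
theorem IsNormalFrame.ballConst_mul_vol_le {n m : ℕ} {V : Set (Euc n)}
    {φ : Euc n → Euc (n + m + 1)} {ν : Fin (m + 1) → Euc n → Euc (n + m + 1)}
    (hν : IsNormalFrame V φ ν) (hn : 1 ≤ n) {W : Submodule ℝ (Euc (n + m + 1))}
    (hW : Module.finrank ℝ W = n + 1)
    (h : IsLocalParam ((W : Set _) ∩ unitSphere (n + m)) V φ) {D : Set (Euc n)}
    (hD : MeasurableSet D) (hDV : D ⊆ V) :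
    ballConst n m * vol n (φ '' D) ≤ splitVolume n m (coneSet W (φ '' D)) := by
  have hVo := h.isOpen_source
  have hmem : ∀ v ∈ V, φ v ∈ W := fun v hv => (h.image_subset ⟨v, hv, rfl⟩).1
  have h1 := h.norm_eq_one inter_subset_right
  let Y : Set (Euc (m + 1)) := Metric.ball 0 1 ∩ {y | 0 < y 0}
  have hY : MeasurableSet Y := by
    refine measurableSet_ball.inter (measurableSet_lt measurable_const ?_)
    fun_prop
  have hproj : ∀ z ∈ D ×ˢ Y, W.starProjection (normalMap ν z) = z.2 0 • φ z.1 := fun z hz => by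
    have hq := hν.sub_mem_normalSpaceAt (hDV hz.1) z.2
    rw [normalSpaceAt_eq_of_forall_mem hVo (h.smooth.differentiableOn (by simp)) h1 hW hmem
      (hDV hz.1) (h.immersion _ (hDV hz.1)), ← Submodule.starProjection_apply_eq_zero_iff,
      map_sub, map_smul, Submodule.starProjection_eq_self_iff.2 (hmem _ (hDV hz.1))] at hq
    exact sub_eq_zero.1 hq
  have hnorm : ∀ z ∈ D ×ˢ Y, ‖W.starProjection (normalMap ν z)‖ = z.2 0 := fun z hz => by
    rw [hproj z hz, norm_smul, h1 _ (hDV hz.1), mul_one, Real.norm_of_nonneg (le_of_lt hz.2.2)]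
  have hdir : ∀ z ∈ D ×ˢ Y, ‖W.starProjection (normalMap ν z)‖⁻¹ •
      W.starProjection (normalMap ν z) = φ z.1 := fun z hz => by
    rw [hnorm z hz, hproj z hz, smul_smul, inv_mul_cancel₀ (ne_of_gt hz.2.2), one_smul]
  have hinj : InjOn (splitEquiv n m ∘ normalMap ν) (D ×ˢ Y) := by
    refine (splitEquiv n m).injective.injOn.comp (t := univ) ?_ (mapsTo_univ _ _)
    intro z hz w hw hzw
    have h2 : z.1 = w.1 := h.injOn (hDV hz.1) (hDV hw.1) (by rw [← hdir z hz, ← hdir w hw, hzw])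
    refine Prod.ext h2 ?_
    ext j
    rw [← hν.inner_normalMap (hDV hz.1) j, ← hν.inner_normalMap (hDV hw.1) j, hzw, h2]
  have hsub : normalMap ν '' (D ×ˢ Y) ⊆ coneSet W (φ '' D) := by
    rintro _ ⟨z, hz, rfl⟩
    refine ⟨?_, ?_, ?_⟩
    · rw [mem_ball_zero_iff, hν.norm_normalMap (hDV hz.1)]
      simpa using hz.2.1
    · rw [mem_ofPred_eq, ← norm_ne_zero_iff, hnorm z hz]
      exact ne_of_gt hz.2.2
    · rw [mem_preimage, hdir z hz]
      exact ⟨z.1, hz.1, rfl⟩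
  have hder : ∀ z ∈ D ×ˢ Y, HasFDerivWithinAt (splitEquiv n m ∘ normalMap ν)
      ((splitEquiv n m : Euc (n + m + 1) →L[ℝ] Euc n × Euc (m + 1)) ∘L
        fderiv ℝ (normalMap ν) z) (D ×ˢ Y) z := fun z hz =>
    ((splitEquiv n m : Euc (n + m + 1) →L[ℝ] Euc n × Euc (m + 1)).hasFDerivAt.comp z
      (hν.hasFDerivAt_normalMap hVo (hDV hz.1)).differentiableAt.hasFDerivAt).hasFDerivWithinAt
  refine le_trans ?_ (measure_mono hsub)
  have := isAddHaarMeasure_volume_prod n m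
  rw [splitVolume_apply, ← image_comp, ← lintegral_abs_det_fderiv_eq_addHaar_image volume
    (hD.prod hY) hder hinj, ← (IsNormalFrame.lintegral_eq_ballConst_mul h hD hDV).2]
  have hss : D ×ˢ Y ⊆ D ×ˢ Metric.ball 0 1 := prod_mono_right inter_subset_left
  rw [← inter_eq_self_of_subset_left hss, ← setLIntegral_indicator (hD.prod hY)]
  refine setLIntegral_mono' (hD.prod measurableSet_ball) fun z hz => ?_
  by_cases hy : 0 < z.2 0
  · have hzm : z ∈ D ×ˢ Y := ⟨hz.1, hz.2, hy⟩
    rw [indicator_of_mem hzm]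
    have hr := normDet_pos (L := (fderiv ℝ φ z.1).toLinearMap) (h.immersion _ (hDV hz.1))
    have hJ := hν.abs_det_mul_normDet hVo h.smooth (hDV hz.1 : z.1 ∈ V)
    have hB := hν.heightHess_eq_of_secondFundForm_eq_zero hVo h.smooth (hDV hz.1) z.2
      fun a b => isTotallyGeodesic_greatSphere hW V φ h z.1 (hDV hz.1) a b
    rw [show ((z.1, z.2) : Euc n × Euc (m + 1)) = z from rfl] at hB
    rw [hB, Matrix.det_smul, Fintype.card_fin, ← normDet_fderiv_sq, sq, ← mul_assoc,
      abs_of_nonneg (mul_nonneg (mul_nonneg (pow_nonneg hy.le n) hr.le) hr.le)] at hJ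
    rw [mul_right_cancel₀ hr.ne' hJ, ← ENNReal.ofReal_pow hy.le, mul_comm,
      ENNReal.ofReal_mul (by positivity)]
  -- The half `y₀ ≤ 0` contributes nothing because `n ≥ 1` makes the truncated power vanish.
  · rw [ENNReal.ofReal_of_nonpos (not_lt.1 hy), zero_pow (by omega), mul_zero]
    exact zero_le

theorem ballConst_mul_vol_greatSphere_le {n m : ℕ} (hn : 1 ≤ n)
    {W : Submodule ℝ (Euc (n + m + 1))} (hW : Module.finrank ℝ W = n + 1) :
    ballConst n m * vol n ((W : Set _) ∩ unitSphere (n + m)) ≤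
      splitVolume n m (Metric.ball 0 1) := by
  have hS := isClosedSubmanifoldOfSphere_greatSphere (k := n + m) hW
  refine le_trans ?_ (measure_mono (inter_subset_left : coneSet W
    ((W : Set _) ∩ unitSphere (n + m)) ⊆ _))
  refine le_of_forall_exists_open_le (fun A => ballConst n m * vol n A)
    (fun A => splitVolume n m (coneSet W A)) hS.isCompact.measurableSet (by simp [vol])
    (fun t => ?_) (fun t ht hd _ => ?_) fun x hx => ?_
  · rw [ENNReal.tsum_mul_left]
    gcongr
    exact measure_iUnion_le _
  · rw [← measure_iUnion _ fun i => measurableSet_coneSet W (ht i)]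
    · refine measure_mono (iUnion_subset fun i p hp => ⟨hp.1, hp.2.1, mem_iUnion.2 ⟨i, hp.2.2⟩⟩)
    · intro i j hij
      exact disjoint_left.2 fun p hp hq => disjoint_left.1 (hd hij) hp.2.2 hq.2.2
  · obtain ⟨V, φ, ν, h, hν, hxV⟩ :=
      exists_isLocalParam_isNormalFrame hS.isSubmanifold hS.subset_sphere hx
    obtain ⟨U, hU, hUe⟩ := h.isOpen_image
    refine ⟨U, hU, by rw [hUe] at hxV; exact hxV.2, fun D hD hDm => ?_⟩
    obtain ⟨D', hD'V, hD'm, rfl⟩ := h.eq_image_of_subset hDm (by rw [hUe]; exact hD)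
    exact hν.ballConst_mul_vol_le hn hW h hD'm hD'V

/-! ### Rigidity of totally geodesic submanifolds. -/

namespace IsNormalFrame

variable {n m : ℕ} {V : Set (Euc n)} {φ : Euc n → Euc (n + m + 1)}
  {ν : Fin (m + 1) → Euc n → Euc (n + m + 1)}

theorem succ_mem_normalSpaceAt (hν : IsNormalFrame V φ ν) {u : Euc n} (hu : u ∈ V) (j : Fin m) :
    ν j.succ u ∈ normalSpaceAt φ u := by
  have h := hν.sub_mem_normalSpaceAt hu (EuclideanSpace.single j.succ 1)
  simpa [normalMap, Fin.succ_ne_zero] using h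

theorem inner_fderiv_succ_eq_zero (hν : IsNormalFrame V φ ν) (hV : IsOpen V)
    (hφ : ContDiffOn ℝ ((⊤ : ℕ∞) : WithTop ℕ∞) φ V) {u : Euc n} (hu : u ∈ V)
    (hII : ∀ a b, secondFundForm φ u a b = 0) (j : Fin m) (a b : Euc n) :
    ⟪fderiv ℝ (ν j.succ) u a, fderiv ℝ φ u b⟫_ℝ = 0 := by
  have h := Submodule.starProjection_eq_self_iff.2 (hν.succ_mem_normalSpaceAt hu j)
  rw [hν.inner_fderiv_fderiv hV hφ hu, ← h, Submodule.inner_starProjection_left_eq_right]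
  have h2 := hII a b
  rw [secondFundForm] at h2
  rw [h2, inner_zero_right, neg_zero]

/-- Differentiating orthonormality: the connection coefficients `⟨ν_l, dν_j⟩` are antisymmetric. -/
theorem inner_fderiv_add (hν : IsNormalFrame V φ ν) (hV : IsOpen V) {u : Euc n} (hu : u ∈ V)
    (j l : Fin (m + 1)) (a : Euc n) :
    ⟪ν l u, fderiv ℝ (ν j) u a⟫_ℝ + ⟪ν j u, fderiv ℝ (ν l) u a⟫_ℝ = 0 := by
  have hj := hν.differentiableAt hV j hu
  have hl := hν.differentiableAt hV l hu
  have he : (fun v => ⟪ν l v, ν j v⟫_ℝ) =ᶠ[𝓝 u] fun _ => if l = j then 1 else 0 := by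
    filter_upwards [hV.mem_nhds hu] with v hv
    exact orthonormal_iff_ite.1 (hν.orthonormal v hv) l j
  have h3 := congrArg (fun L => L a) (he.fderiv_eq (𝕜 := ℝ))
  rw [fderiv_fun_const] at h3
  simp only [fderiv_inner_apply ℝ hl hj] at h3
  rw [real_inner_comm (ν j u)] at h3
  simpa using h3

/-- The tangential part of `dν_j` vanishes because `II = 0`, and the `φ` component vanishes by
antisymmetry because `dφ` is tangential. -/
theorem fderiv_succ_eq_sum (hν : IsNormalFrame V φ ν) (hV : IsOpen V)
    (hφ : ContDiffOn ℝ ((⊤ : ℕ∞) : WithTop ℕ∞) φ V) {u : Euc n} (hu : u ∈ V)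
    (hinj : Function.Injective (fderiv ℝ φ u))
    (hII : ∀ a b, secondFundForm φ u a b = 0) (j : Fin m) (a : Euc n) :
    fderiv ℝ (ν j.succ) u a =
      ∑ l : Fin m, ⟪ν l.succ u, fderiv ℝ (ν j.succ) u a⟫_ℝ • ν l.succ u := by
  obtain ⟨y, hy⟩ := hν.exists_normalMap_eq hu hinj
    (hν.inner_fderiv_succ_eq_zero hV hφ hu hII j a)
  have hc : ∀ l, y l = ⟪ν l u, fderiv ℝ (ν j.succ) u a⟫_ℝ := fun l => by
    rw [← hy, hν.inner_normalMap (z := (u, y)) hu]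
  have h00 : fderiv ℝ (ν 0) u = fderiv ℝ φ u := by
    refine Filter.EventuallyEq.fderiv_eq ?_
    filter_upwards [hV.mem_nhds hu] with v hv using hν.zero v hv
  have h0 : y 0 = 0 := by
    have h := hν.inner_fderiv_add hV hu j.succ 0 a
    rw [h00, real_inner_comm _ (ν j.succ u), hν.inner_fderiv u hu, add_zero] at h
    rw [hc, h]
  conv_lhs => rw [← hy, normalMap, Fin.sum_univ_succ]
  simp only [h0, zero_smul, zero_add, hc]

/-- The orthogonal projection to the normal space in the sphere has zero derivative if the second
fundamental form vanishes. -/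
theorem fderiv_normalProjection (hν : IsNormalFrame V φ ν) (hV : IsOpen V)
    (hφ : ContDiffOn ℝ ((⊤ : ℕ∞) : WithTop ℕ∞) φ V) {u : Euc n} (hu : u ∈ V)
    (hinj : Function.Injective (fderiv ℝ φ u))
    (hII : ∀ a b, secondFundForm φ u a b = 0) (w : Euc (n + m + 1)) :
    DifferentiableAt ℝ (fun v => ∑ j : Fin m, ⟪ν j.succ v, w⟫_ℝ • ν j.succ v) u ∧
    fderiv ℝ (fun v => ∑ j : Fin m, ⟪ν j.succ v, w⟫_ℝ • ν j.succ v) u = 0 := by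
  have hd : ∀ j : Fin m, DifferentiableAt ℝ (ν j.succ) u := fun j => hν.differentiableAt hV _ hu
  have hi : ∀ j : Fin m, DifferentiableAt ℝ (fun v => ⟪ν j.succ v, w⟫_ℝ) u := fun j =>
    (hd j).inner ℝ (differentiableAt_const w)
  have hs : ∀ j : Fin m, DifferentiableAt ℝ (fun v => ⟪ν j.succ v, w⟫_ℝ • ν j.succ v) u :=
    fun j => (hi j).smul (hd j)
  refine ⟨DifferentiableAt.fun_sum fun j _ => hs j, ?_⟩
  ext1 a
  rw [fderiv_fun_sum fun j _ => hs j, sum_apply]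
  have h1 : ∀ j : Fin m, fderiv ℝ (fun v => ⟪ν j.succ v, w⟫_ℝ • ν j.succ v) u a =
      ∑ l : Fin m, (⟪ν l.succ u, fderiv ℝ (ν j.succ) u a⟫_ℝ * ⟪ν l.succ u, w⟫_ℝ) • ν j.succ u +
      ∑ l : Fin m, (⟪ν l.succ u, fderiv ℝ (ν j.succ) u a⟫_ℝ * ⟪ν j.succ u, w⟫_ℝ) • ν l.succ u := by
    intro j
    have h2 : fderiv ℝ (fun v => ⟪ν j.succ v, w⟫_ℝ) u a =
        ∑ l : Fin m, ⟪ν l.succ u, fderiv ℝ (ν j.succ) u a⟫_ℝ * ⟪ν l.succ u, w⟫_ℝ := by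
      rw [fderiv_inner_apply ℝ (hd j) (differentiableAt_const w)]
      rw [fderiv_fun_const]
      simp only [Pi.zero_apply, zero_apply, inner_zero_right, zero_add]
      conv_lhs => rw [hν.fderiv_succ_eq_sum hV hφ hu hinj hII j a, sum_inner]
      simp only [inner_smul_left, conj_trivial]
    rw [fderiv_fun_smul (hi j) (hd j)]
    simp only [add_apply, smul_apply, ContinuousLinearMap.smulRight_apply]
    rw [h2, Finset.sum_smul]
    refine (add_comm _ _).trans ?_
    congr 1
    conv_lhs => rw [hν.fderiv_succ_eq_sum hV hφ hu hinj hII j a, Finset.smul_sum]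
    refine Finset.sum_congr rfl fun l _ => ?_
    rw [smul_smul, mul_comm]
  simp only [h1, Finset.sum_add_distrib]
  -- After exchanging the indices in one double sum, the terms cancel in pairs by antisymmetry of
  -- the connection coefficients.
  rw [Finset.sum_comm (f := fun (j l : Fin m) =>
    (⟪ν l.succ u, fderiv ℝ (ν j.succ) u a⟫_ℝ * ⟪ν j.succ u, w⟫_ℝ) • ν l.succ u),
    ← Finset.sum_add_distrib, zero_apply]
  refine Finset.sum_eq_zero fun j _ => ?_
  rw [← Finset.sum_add_distrib]
  refine Finset.sum_eq_zero fun l _ => ?_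
  rw [← add_smul, ← add_mul, hν.inner_fderiv_add hV hu, zero_mul, zero_smul]

/-- `W` is the orthogonal complement of the normal space at `u₀`. The normal projection is constant
on the connected set `V` and annihilates `φ u` at `u`, hence also at `u₀`. -/
theorem exists_submodule (hν : IsNormalFrame V φ ν) (hV : IsOpen V) (hVc : IsPreconnected V)
    (hφ : ContDiffOn ℝ ((⊤ : ℕ∞) : WithTop ℕ∞) φ V)
    (himm : ∀ u ∈ V, Function.Injective (fderiv ℝ φ u))
    (hII : ∀ u ∈ V, ∀ a b, secondFundForm φ u a b = 0) {u₀ : Euc n} (hu₀ : u₀ ∈ V) :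
    ∃ W : Submodule ℝ (Euc (n + m + 1)), Module.finrank ℝ W = n + 1 ∧ ∀ u ∈ V, φ u ∈ W := by
  have ho : Orthonormal ℝ fun j : Fin m => ν j.succ u₀ :=
    (hν.orthonormal u₀ hu₀).comp _ (Fin.succ_injective m)
  refine ⟨(Submodule.span ℝ (range fun j : Fin m => ν j.succ u₀))ᗮ, ?_, fun u hu => ?_⟩
  · have h := (Submodule.span ℝ (range fun j : Fin m => ν j.succ u₀)).finrank_add_finrank_orthogonal
    rw [finrank_span_eq_card ho.linearIndependent, Fintype.card_fin,
      finrank_euclideanSpace_fin] at h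
    omega
  · have hconst := hV.is_const_of_fderiv_eq_zero (𝕜 := ℝ) hVc
      (fun v hv => (hν.fderiv_normalProjection hV hφ hv (himm v hv) (hII v hv)
        (φ u)).1.differentiableWithinAt)
      (fun v hv => (hν.fderiv_normalProjection hV hφ hv (himm v hv) (hII v hv) (φ u)).2)
      hu₀ hu
    have hz : ∑ j : Fin m, ⟪ν j.succ u, φ u⟫_ℝ • ν j.succ u = 0 := by
      refine Finset.sum_eq_zero fun j _ => ?_
      rw [← hν.zero u hu, (hν.orthonormal u hu).2 (Fin.succ_ne_zero j), zero_smul]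
    rw [hz] at hconst
    rw [Submodule.mem_orthogonal]
    intro w hw
    induction hw using Submodule.span_induction with
    | mem w hw =>
      obtain ⟨j, rfl⟩ := hw
      have h := congrArg (fun w => ⟪ν j.succ u₀, w⟫_ℝ) hconst
      simp only [inner_zero_right] at h
      rwa [ho.inner_right_fintype] at h
    | zero => exact inner_zero_left _
    | add x y _ _ hx hy => rw [inner_add_left, hx, hy, add_zero]
    | smul c x _ hx => rw [inner_smul_left, hx, mul_zero]

/-- A totally geodesic piece of a great sphere is open in the great sphere. -/
theorem eventually_mem_image (hν : IsNormalFrame V φ ν) (hV : IsOpen V)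
    (hφ : ContDiffOn ℝ ((⊤ : ℕ∞) : WithTop ℕ∞) φ V)
    (himm : ∀ u ∈ V, Function.Injective (fderiv ℝ φ u)) (h1 : ∀ u ∈ V, ‖φ u‖ = 1)
    {W : Submodule ℝ (Euc (n + m + 1))} (hW : Module.finrank ℝ W = n + 1)
    (hmem : ∀ u ∈ V, φ u ∈ W) {u : Euc n} (hu : u ∈ V)
    (hII : ∀ a b, secondFundForm φ u a b = 0) :
    ∀ᶠ p in 𝓝 (φ u), p ∈ (W : Set _) ∩ unitSphere (n + m) → p ∈ φ '' V := by
  -- At this preimage of `φ u` one has `B = g`, so the inverse function theorem applies. For nearby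
  -- `p` in the great sphere, comparing components in `W` and `Wᗮ` gives `p = y₀ φ v` for some `v ∈
  -- V`, and unit norms give `y₀ = 1`.
  let z : Euc n × Euc (m + 1) := (u, EuclideanSpace.single 0 1)
  have hFz : normalMap ν z = φ u := by
    simp [normalMap, z, hν.zero u hu]
  let J : Euc (n + m + 1) →L[ℝ] Euc n × Euc (m + 1) := splitEquiv n m
  have hdet : (J ∘L fderiv ℝ (normalMap ν) z).det ≠ 0 := by
    have h := hν.abs_det_mul_normDet hV hφ (z := z) hu
    have hr := normDet_pos (L := (fderiv ℝ φ u).toLinearMap) (himm u hu)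
    have hB := hν.heightHess_eq_of_secondFundForm_eq_zero hV hφ hu (EuclideanSpace.single 0 1) hII
    intro h0
    change |(J ∘L fderiv ℝ (normalMap ν) z).det| * _ = _ at h
    change heightHess φ (normalMap ν z) z.1 = _ at hB
    rw [h0, abs_zero, zero_mul, hB, Matrix.det_smul, ← normDet_fderiv_sq] at h
    simp only [PiLp.single_apply, if_true, one_pow, one_mul] at h
    rw [eq_comm, abs_eq_zero] at h
    exact (pow_ne_zero 2 hr.ne') h
  have hst : HasStrictFDerivAt (J ∘ normalMap ν) (J ∘L fderiv ℝ (normalMap ν) z) z := by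
    refine J.hasStrictFDerivAt.comp z ?_
    exact (hν.contDiffOn_normalMap.contDiffAt
      ((hV.prod isOpen_univ).mem_nhds ⟨hu, mem_univ _⟩)).hasStrictFDerivAt one_ne_zero
  have hmap := HasStrictFDerivAt.map_nhds_eq_of_equiv
    (f' := (J ∘L fderiv ℝ (normalMap ν) z).toContinuousLinearEquivOfDetNeZero hdet) (by simpa using hst)
  have hO : IsOpen {w : Euc n × Euc (m + 1) | w.1 ∈ V ∧ 0 < w.2 0} := by
    have hpos : IsOpen {w : Euc n × Euc (m + 1) | 0 < w.2 0} :=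
      isOpen_lt continuous_const (by fun_prop)
    exact (hV.preimage continuous_fst).inter hpos
  have hev := image_mem_map (m := J ∘ normalMap ν) (hO.mem_nhds (x := z) ⟨hu, by simp [z]⟩)
  rw [hmap] at hev
  have hJ : Tendsto J (𝓝 (φ u)) (𝓝 ((J ∘ normalMap ν) z)) := by
    rw [Function.comp_apply, hFz]
    exact J.continuous.tendsto _
  filter_upwards [hJ hev] with p hp hpW
  obtain ⟨w, ⟨hwV, hw0⟩, hwp⟩ := hp
  have hwp' : normalMap ν w = p := (splitEquiv n m).injective hwp
  have hq := hν.sub_mem_normalSpaceAt hwV w.2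
  rw [normalSpaceAt_eq_of_forall_mem hV (hφ.differentiableOn (by simp)) h1 hW hmem hwV
    (himm _ hwV)] at hq
  change normalMap ν w - _ ∈ _ at hq
  rw [hwp'] at hq
  have hqW : p - w.2 0 • φ w.1 ∈ W := W.sub_mem hpW.1 (W.smul_mem _ (hmem _ hwV))
  have hpe : p = w.2 0 • φ w.1 :=
    sub_eq_zero.1 (Submodule.disjoint_def.1 W.orthogonal_disjoint _ hqW hq)
  have hnorm : ‖p‖ = 1 := by simpa [unitSphere] using hpW.2
  have hw1 : w.2 0 = 1 := by
    rw [hpe, norm_smul, h1 _ hwV, mul_one, Real.norm_of_nonneg hw0.le] at hnorm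
    exact hnorm
  rw [hw1, one_smul] at hpe
  exact ⟨w.1, hwV, hpe.symm⟩

end IsNormalFrame

theorem isPreconnected_unitSphere {n : ℕ} (hn : 1 ≤ n) : IsPreconnected (unitSphere n) := by
  refine (isConnected_sphere ?_ 0 zero_le_one).isPreconnected
  rw [← Module.finrank_eq_rank, finrank_euclideanSpace_fin]
  exact_mod_cast (by omega : 1 < n + 1)

theorem isPreconnected_greatSphere {n k : ℕ} (hn : 1 ≤ n) {W : Submodule ℝ (Euc (k + 1))}
    (hW : Module.finrank ℝ W = n + 1) : IsPreconnected ((W : Set _) ∩ unitSphere k) := by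
  obtain ⟨L, hL⟩ := exists_isometry_image_unitSphere hW
  rw [← hL]
  exact (isPreconnected_unitSphere hn).image _ L.continuous.continuousOn

/-- A totally geodesic closed submanifold contains a great sphere through each of its points, as
a relatively open subset. -/
theorem IsTotallyGeodesic.exists_greatSphere_subset {n m : ℕ} (hn : 1 ≤ n)
    {S : Set (Euc (n + m + 1))} (hS : IsClosedSubmanifoldOfSphere n (n + m) S)
    (hTG : IsTotallyGeodesic n S) :
    ∃ W : Submodule ℝ (Euc (n + m + 1)), Module.finrank ℝ W = n + 1 ∧
      (W : Set _) ∩ unitSphere (n + m) ⊆ S ∧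
      ∀ y ∈ (W : Set _) ∩ unitSphere (n + m), ∀ᶠ x in 𝓝[S] y, x ∈ W := by
  have hlocal : ∀ x ∈ S, ∃ (V : Set (Euc n)) (φ : Euc n → Euc (n + m + 1))
      (ν : Fin (m + 1) → Euc n → Euc (n + m + 1)) (W : Submodule ℝ (Euc (n + m + 1))),
      IsLocalParam S V φ ∧ IsNormalFrame V φ ν ∧ x ∈ φ '' V ∧ Module.finrank ℝ W = n + 1 ∧
        ∀ u ∈ V, φ u ∈ W := fun x hx => by
    obtain ⟨V, φ, ν, h, hν, u, hu, rfl⟩ :=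
      exists_isLocalParam_isNormalFrame hS.isSubmanifold hS.subset_sphere hx
    obtain ⟨r, hr, hrV⟩ := Metric.isOpen_iff.1 h.isOpen_source u hu
    have h' := h.mono Metric.isOpen_ball hrV
    have hν' : IsNormalFrame (Metric.ball u r) φ ν := hν.mono hrV
    obtain ⟨W, hW, hmem⟩ := hν'.exists_submodule Metric.isOpen_ball
      (convex_ball u r).isPreconnected h'.smooth h'.immersion (hTG _ φ h') (Metric.mem_ball_self hr)
    exact ⟨_, φ, ν, W, h', hν', ⟨u, Metric.mem_ball_self hr, rfl⟩, hW, hmem⟩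
  obtain ⟨x₀, hx₀⟩ := hS.nonempty
  obtain ⟨V₀, φ₀, ν₀, W, h₀, -, hxV₀, hW, hmem₀⟩ := hlocal x₀ hx₀
  set G := (W : Set _) ∩ unitSphere (n + m) with hG
  -- The points near which `S` lies in `W`. This set is shown to be nonempty, open and closed in the
  -- connected great sphere `G`, hence all of it.
  let D : Set (Euc (n + m + 1)) := {y | y ∈ S ∧ ∃ U, IsOpen U ∧ y ∈ U ∧ S ∩ U ⊆ (W : Set _)}
  have hDopen : ∀ y ∈ D, ∃ O, IsOpen O ∧ y ∈ O ∧ G ∩ O ⊆ D := by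
    rintro y ⟨hyS, U, hU, hyU, hUW⟩
    obtain ⟨V, φ, ν, -, h, hν, ⟨u, hu, rfl⟩, -, -⟩ := hlocal y hyS
    have hV' : IsOpen (V ∩ φ ⁻¹' U) :=
      h.smooth.continuousOn.isOpen_inter_preimage h.isOpen_source hU
    have h' := h.mono hV' inter_subset_left
    have hev := (hν.mono inter_subset_left).eventually_mem_image hV' h'.smooth h'.immersion
      (h'.norm_eq_one hS.subset_sphere) hW
      (fun v hv => hUW ⟨h.image_subset ⟨v, hv.1, rfl⟩, hv.2⟩) ⟨hu, hyU⟩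
      (hTG _ φ h' u ⟨hu, hyU⟩)
    obtain ⟨O, hO, hOo, huO⟩ := eventually_nhds_iff.1 hev
    refine ⟨O, hOo, huO, fun p hp => ?_⟩
    obtain ⟨v, hv, rfl⟩ := hO p hp.2 hp.1
    exact ⟨h.image_subset ⟨v, hv.1, rfl⟩, U, hU, hv.2, hUW⟩
  have hDclosed : IsClosed D := by
    refine isClosed_of_closure_subset fun y hy => ?_
    have hyS : y ∈ S := hS.isCompact.isClosed.closure_subset_iff.2 (fun p hp => hp.1) hy
    obtain ⟨V, φ, ν, W', h, -, hyV, hW', hmem'⟩ := hlocal y hyS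
    obtain ⟨U, hU, hUe⟩ := h.isOpen_image
    have hyU : y ∈ U := by
      rw [hUe] at hyV
      exact hyV.2
    obtain ⟨p, hpU, hpS, U', hU', hpU', hUW'⟩ := mem_closure_iff.1 hy U hU hyU
    have hpV : p ∈ φ '' V := by
      rw [hUe]
      exact ⟨hpS, hpU⟩
    obtain ⟨v, hv, rfl⟩ := hpV
    have hV' : IsOpen (V ∩ φ ⁻¹' U') :=
      h.smooth.continuousOn.isOpen_inter_preimage h.isOpen_source hU'
    have h' := h.mono hV' inter_subset_left
    have heq : ∀ W'' : Submodule ℝ (Euc (n + m + 1)), Module.finrank ℝ W'' = n + 1 →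
        (∀ w ∈ V ∩ φ ⁻¹' U', φ w ∈ W'') →
        tangentSpaceAt φ v ⊔ Submodule.span ℝ {φ v} = W'' := fun W'' hW'' hm =>
      tangentSpaceAt_sup_eq_of_forall_mem hV' (h'.smooth.differentiableOn (by simp))
        (h'.norm_eq_one hS.subset_sphere) hW'' hm ⟨hv, hpU'⟩ (h.immersion v hv)
    -- Both subspaces contain a common piece of the chart near `φ v`, and the tangent data there
    -- determine either one.
    have hWW' : W' = W := (heq W' hW' fun w hw => hmem' w hw.1).symm.trans
      (heq W hW fun w hw => hUW' ⟨h.image_subset ⟨w, hw.1, rfl⟩, hw.2⟩)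
    refine ⟨hyS, U, hU, hyU, ?_⟩
    rw [← hUe]
    rintro _ ⟨w, hw, rfl⟩
    rw [← hWW']
    exact hmem' w hw
  have hDG : D ⊆ G := fun y ⟨hyS, U, _, hyU, hUW⟩ => ⟨hUW ⟨hyS, hyU⟩, hS.subset_sphere hyS⟩
  have hx₀D : x₀ ∈ D := by
    obtain ⟨U, hU, hUe⟩ := h₀.isOpen_image
    refine ⟨hx₀, U, hU, ?_, ?_⟩
    · rw [hUe] at hxV₀
      exact hxV₀.2
    · rw [← hUe]
      rintro _ ⟨w, hw, rfl⟩
      exact hmem₀ w hw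
  choose! O hOo hyO hOD using hDopen
  have hGD : G ⊆ D := by
    by_contra hcon
    obtain ⟨q, hqG, hqD⟩ := not_subset.1 hcon
    obtain ⟨p, hpG, hpO, hpD⟩ := isPreconnected_greatSphere hn hW (⋃ y ∈ D, O y) Dᶜ
      (isOpen_biUnion fun y hy => hOo y hy) hDclosed.isOpen_compl
      (fun p _ => by
        by_cases hp : p ∈ D
        · exact Or.inl (mem_biUnion hp (hyO p hp))
        · exact Or.inr hp)
      ⟨x₀, hDG hx₀D, mem_biUnion hx₀D (hyO x₀ hx₀D)⟩ ⟨q, hqG, hqD⟩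
    obtain ⟨y, hy, hpy⟩ := mem_iUnion₂.1 hpO
    exact hpD (hOD y hy ⟨hpG, hpy⟩)
  refine ⟨W, hW, fun y hy => (hGD hy).1, fun y hy => ?_⟩
  obtain ⟨hyS, U, hU, hyU, hUW⟩ := hGD hy
  filter_upwards [self_mem_nhdsWithin, mem_nhdsWithin_of_mem_nhds (hU.mem_nhds hyU)] with x hx hxU
  exact hUW ⟨hx, hxU⟩

/-- The great sphere found inside `S` is closed and relatively open, and `S` is connected, being
homeomorphic to `𝕊^n` with `n ≥ 1`. -/
theorem IsTotallyGeodesicSphere.isGreatSphere {n m : ℕ} (hn : 1 ≤ n)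
    {S : Set (Euc (n + m + 1))} (hS : IsClosedSubmanifoldOfSphere n (n + m) S)
    (h : IsTotallyGeodesicSphere n S) : IsGreatSphere n (n + m) S := by
  obtain ⟨W, hW, hsub, hev⟩ := h.1.exists_greatSphere_subset hn hS
  refine ⟨W, hW, Subset.antisymm (fun x hx => ?_) hsub⟩
  have hSc : IsPreconnected S := by
    obtain ⟨e⟩ := h.2
    have h1 : PreconnectedSpace (unitSphere n) :=
      isPreconnected_iff_preconnectedSpace.1 (isPreconnected_unitSphere hn)
    have h2 := isPreconnected_range (f := fun z => (e.symm z : Euc (n + m + 1)))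
      (continuous_subtype_val.comp e.symm.continuous)
    rwa [range_comp' Subtype.val e.symm, e.symm.surjective.range_eq, image_univ,
      Subtype.range_coe] at h2
  have hGc : IsClosed ((W : Set _) ∩ unitSphere (n + m)) :=
    (Submodule.closed_of_finiteDimensional W).inter Metric.isClosed_sphere
  have hG := isClosedSubmanifoldOfSphere_greatSphere (k := n + m) hW
  by_contra hxG
  have hop : ∀ y ∈ (W : Set _) ∩ unitSphere (n + m), ∃ U, IsOpen U ∧ y ∈ U ∧
      U ∩ S ⊆ (W : Set _) := fun y hy => by
    obtain ⟨U, hU, hyU, hUs⟩ := mem_nhdsWithin.1 (hev y hy)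
    exact ⟨U, hU, hyU, hUs⟩
  choose! U hU hyU hUs using hop
  obtain ⟨y₀, hy₀⟩ := hG.nonempty
  obtain ⟨p, hpS, hpU, hpG⟩ := hSc (⋃ y ∈ (W : Set _) ∩ unitSphere (n + m), U y)
    ((W : Set _) ∩ unitSphere (n + m))ᶜ (isOpen_biUnion fun y hy => hU y hy) hGc.isOpen_compl
    (fun p _ => by
      by_cases hp : p ∈ (W : Set _) ∩ unitSphere (n + m)
      · exact Or.inl (mem_biUnion hp (hyU p hp))
      · exact Or.inr hp)
    ⟨y₀, hsub hy₀, mem_biUnion hy₀ (hyU y₀ hy₀)⟩ ⟨x, hx, hxG⟩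
  obtain ⟨y, hy, hpy⟩ := mem_iUnion₂.1 hpU
  exact hpG ⟨hUs y hy ⟨hpy, hpS⟩, hS.subset_sphere hpS⟩

theorem IsLocalParam.vol_image_ne_zero {n N : ℕ} {S : Set (Euc N)} {V : Set (Euc n)}
    {φ : Euc n → Euc N} (h : IsLocalParam S V φ) (hne : V.Nonempty) : vol n (φ '' V) ≠ 0 := by
  have hVm := h.isOpen_source.measurableSet
  rw [vol_image_eq_lintegral h.isOpen_source (h.smooth.of_le (by simp)) h.injOn h.immersion
    hVm Subset.rfl, Ne, lintegral_eq_zero_iff'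
    (((continuousOn_normDet_fderiv (h.smooth.continuousOn_fderiv_of_isOpen h.isOpen_source
      (by simp))).aemeasurable hVm).ennreal_ofReal)]
  intro h0
  have h1 := (ae_restrict_iff' hVm).1 h0
  have h2 : volume V = 0 := by
    refine measure_mono_null (fun u hu => ?_) (ae_iff.1 h1)
    have hr := normDet_pos (L := (fderiv ℝ φ u).toLinearMap) (h.immersion u hu)
    simpa [hu] using hr
  exact (h.isOpen_source.measure_pos volume hne).ne' h2

/-- The great sphere inside `S` already has the full finite volume, so its complement in `S` is
null; but that complement is relatively open, and a nonempty one would contain a chart image of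
positive volume. -/
theorem IsTotallyGeodesic.isGreatSphere_of_vol_eq {n m : ℕ} (hn : 1 ≤ n)
    {S : Set (Euc (n + m + 1))} (hS : IsClosedSubmanifoldOfSphere n (n + m) S)
    (h : IsTotallyGeodesic n S) (hvol : vol n S = vol n (unitSphere n)) (hfin : vol n S ≠ ⊤) :
    IsGreatSphere n (n + m) S := by
  obtain ⟨W, hW, hsub, hev⟩ := h.exists_greatSphere_subset hn hS
  refine ⟨W, hW, Subset.antisymm (fun x hx => ?_) hsub⟩
  by_contra hxG
  have hGc : IsClosed ((W : Set _) ∩ unitSphere (n + m)) :=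
    (Submodule.closed_of_finiteDimensional W).inter Metric.isClosed_sphere
  have hsum : vol n ((W : Set _) ∩ unitSphere (n + m)) +
      vol n (S \ ((W : Set _) ∩ unitSphere (n + m))) = vol n S := by
    have := measure_inter_add_sdiff (μ := Measure.euclideanHausdorffMeasure n) S
      hGc.measurableSet
    rw [inter_eq_self_of_subset_right hsub] at this
    exact this
  rw [vol_greatSphere hW, ← hvol] at hsum
  have h0 : vol n (S \ ((W : Set _) ∩ unitSphere (n + m))) = 0 :=
    (ENNReal.add_right_inj hfin).1 (hsum.trans (add_zero _).symm)
  obtain ⟨V, φ, hφ, u, hu, rfl⟩ := hS.isSubmanifold x hx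
  have hV' : IsOpen (V ∩ φ ⁻¹' ((W : Set _) ∩ unitSphere (n + m))ᶜ) :=
    hφ.smooth.continuousOn.isOpen_inter_preimage hφ.isOpen_source hGc.isOpen_compl
  refine (hφ.mono hV' inter_subset_left).vol_image_ne_zero ⟨u, hu, hxG⟩
    (measure_mono_null ?_ h0)
  rintro _ ⟨v, hv, rfl⟩
  exact ⟨hφ.image_subset ⟨v, hv.1, rfl⟩, hv.2⟩

theorem exists_submodule_finrank_eq (n m : ℕ) :
    ∃ W : Submodule ℝ (Euc (n + m + 1)), Module.finrank ℝ W = n + 1 := by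
  have hli := (EuclideanSpace.basisFun (Fin (n + m + 1)) ℝ).toBasis.linearIndependent.comp
    (Fin.castLE (by omega : n + 1 ≤ n + m + 1)) (Fin.castLE_injective _)
  exact ⟨_, (finrank_span_eq_card hli).trans (Fintype.card_fin _)⟩

theorem IsGreatSphere.isTotallyGeodesicSphere {n k : ℕ} {S : Set (Euc (k + 1))}
    (h : IsGreatSphere n k S) : IsTotallyGeodesicSphere n S := by
  obtain ⟨W, hW, rfl⟩ := h
  exact ⟨isTotallyGeodesic_greatSphere hW, nonempty_homeomorph_greatSphere hW⟩

theorem IsGreatSphere.vol_eq {n k : ℕ} {S : Set (Euc (k + 1))}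
    (h : IsGreatSphere n k S) : vol n S = vol n (unitSphere n) := by
  obtain ⟨W, hW, rfl⟩ := h
  exact vol_greatSphere hW

end MinSub

theorem mainTheorem6 (n m : ℕ) (hn : 1 ≤ n) (hm : m = 1 ∨ m = 2)
    (S : Set (MinSub.Euc (n + m + 1)))
    (hS : MinSub.IsClosedSubmanifoldOfSphere n (n + m) S)
    (hmin : MinSub.IsMinimal n S) :
    MinSub.vol n (MinSub.unitSphere n) ≤ MinSub.vol n S ∧
      (MinSub.vol n S = MinSub.vol n (MinSub.unitSphere n) ↔
        MinSub.IsTotallyGeodesicSphere n S) ∧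
      (MinSub.IsTotallyGeodesicSphere n S ↔ MinSub.IsGreatSphere n (n + m) S) := by
  open MinSub in
  obtain ⟨W, hW⟩ := exists_submodule_finrank_eq n m
  have hC0 := ballConst_ne_zero hn hS hmin
  have hle := ballConst_mul_vol_greatSphere_le hn hW
  rw [vol_greatSphere hW] at hle
  -- Finiteness of `|𝕊^n|` comes from the reverse inequality: a nonzero constant times it is bounded
  -- by the finite volume of the ball.
  have hfin : vol n (unitSphere n) ≠ ⊤ := fun h => by
    rw [h, ENNReal.mul_top hC0] at hle
    exact (hle.trans_lt (splitVolume_ball_lt_top n m)).ne rfl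
  refine ⟨?_, ⟨fun heq => ?_, fun h => (h.isGreatSphere hn hS).vol_eq⟩,
    fun h => h.isGreatSphere hn hS, fun h => h.isTotallyGeodesicSphere⟩
  · exact (ENNReal.mul_le_mul_iff_right hC0 (ballConst_ne_top n m)).1
      (hle.trans (splitVolume_ball_le hn hS hmin))
  · have hfinS : vol n S ≠ ⊤ := by rwa [heq]
    exact ((isTotallyGeodesic_of_le hn hS hmin hfinS (by rwa [heq])).isGreatSphere_of_vol_eq hn hS
      heq hfinS).isTotallyGeodesicSphere
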